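/- \textbf{Setting.} Let $\mathbb{X}\subset\mathbb{R}^d$ be a Borel set (the state space), let $\mathbb{U}\subset\mathbb{R}^m$ be a compact set (the action space), and let $c:\mathbb{X}\times\mathbb{U}\to\mathbb{R}$ be Borel measurable and bounded, with $u\mapsto c(x,u)$ continuous for every fixed $x$. Let $\mathcal{T}$ and $\mathcal{T}_n$, $n\in\mathbb{N}$, be stochastic kernels from $\mathbb{X}\times\mathbb{U}$ to $\mathbb{X}$. An admissible policy $\gamma$ is a sequence of measurable functions $\gamma_t$ with $U_t=\gamma_t(X_0,\dots,X_t,U_0,\dots,U_{t-1})\in\mathbb{U}$; it is stationary if $U_t=\gamma(X_t)$ for a fixed measurable $\gamma:\mathbb{X}\to\mathbb{U}$. Put $$J_\infty(\mathcal{T},\gamma,x)=\limsup_{N\to\infty}\frac1N E_x^{\mathcal{T},\gamma}\Big[\sum_{t=0}^{N-1}c(X_t,U_t)\Big],\qquad J^*_\infty(\mathcal{T},x)=\inf_\gamma J_\infty(\mathcal{T},\gamma,x),$$ where the controlled process starts from $X_0=x$, has $X_{t+1}\sim\mathcal{T}(\cdot|X_t,U_t)$ given the past, and the infimum is over all admissible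 policies. For a stationary $\gamma$ let $\mathcal{T}^t(\cdot|x,\gamma)$ be the $t$-step transition kernel of the resulting chain. A sequence $\mu_n$ of probability measures converges setwise to $\mu$ if $\int f\,d\mu_n\to\int f\,d\mu$ for every bounded measurable $f$, and $\|\mu-\nu\|_{TV}=\sup_{\|f\|_\infty\le1}|\int f\,d\mu-\int f\,d\nu|$. \textbf{Theorem.} Assume the following. (1) There are an integer $t\ge1$ and a number $0<\beta<1$ such that, for $\mathcal{S}=\mathcal{T}$ and for $\mathcal{S}=\mathcal{T}_n$ with every $n$, $\|\mathcal{S}^t(\cdot|x,\gamma)-\mathcal{S}^t(\cdot|x',\gamma)\|_{TV}\le2\beta$ for all $x,x'\in\mathbb{X}$ and all stationary policies $\gamma$. (2) For every $x\in\mathbb{X}$, $\mathcal{T}(\cdot|x,u)$ is setwise continuous in $u$, that is, $\mathcal{T}(\cdot|x,u_k)\to\mathcal{T}(\cdot|x,u)$ setwise whenever $u_k\to u$ in $\mathbb{U}$. (3) For every $x\in\mathbb{X}$ and every sequence $u_n\to u$ in $\mathbb{U}$, $\mathcal{T}_n(\cdot|x,u_n)\to\mathcal{T}(\cdot|x,u)$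 setwise. For each $n$ let $\gamma_n^*$ be a stationary policy satisfying the average cost optimality equation of $\mathcal{T}_n$: there are a constant $j_n^*$ and a bounded measurable $v_n^*:\mathbb{X}\to\mathbb{R}$ such that for all $x\in\mathbb{X}$ $$j_n^*+v_n^*(x)=\inf_{u\in\mathbb{U}}\Big(c(x,u)+\int v_n^*(y)\,\mathcal{T}_n(dy|x,u)\Big)=c(x,\gamma_n^*(x))+\int v_n^*(y)\,\mathcal{T}_n(dy|x,\gamma_n^*(x)).$$ Then $J_\infty(\mathcal{T},\gamma_n^*,x)\to J_\infty^*(\mathcal{T},x)$ as $n\to\infty$ for every $x\in\mathbb{X}$. -/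

import Mathlib

open Filter Topology MeasureTheory ProbabilityTheory

namespace AvgMDP

variable {X U : Type*} [MeasurableSpace X] [MeasurableSpace U]

/-- The information variable `I_t = (X_{[0,t]}, U_{[0,t-1]})`. -/
abbrev History (X U : Type*) (t : ℕ) : Type _ := (Fin (t + 1) → X) × (Fin t → U)

/-- Admissible policies: sequences of control functions, the `t`-th one being a measurable function
of the information `I_t`, with `U_t = γ_t(I_t)`. -/
structure AdmissiblePolicy (X U : Type*) [MeasurableSpace X] [MeasurableSpace U] where
  act : ∀ t : ℕ, History X U t → U
  measurable_act : ∀ t : ℕ, Measurable (act t)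

/-- Stationary policies: measurable functions of the current state. -/
structure StationaryPolicy (X U : Type*) [MeasurableSpace X] [MeasurableSpace U] where
  act : X → U
  measurable_act : Measurable act

/-- A stationary policy, seen as an admissible policy: `U_t = g(X_t)`. -/
def StationaryPolicy.toAdmissible (g : StationaryPolicy X U) : AdmissiblePolicy X U where
  act t h := g.act (h.1 (Fin.last t))
  measurable_act t := g.measurable_act.comp ((measurable_pi_apply (Fin.last t)).comp measurable_fst)

/-- The conditional law of `X_{t+1}` given `I_t = h`, namely `T(· | X_t, γ_t(h))`. -/
noncomputable def nextState (T : Kernel (X × U) X) (γ : AdmissiblePolicy X U) (t : ℕ) :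
    Kernel (History X U t) X :=
  T.comap (fun h => (h.1 (Fin.last t), γ.act t h))
    (((measurable_pi_apply (Fin.last t)).comp measurable_fst).prodMk (γ.measurable_act t))

/-- The joint law of `I_t = (X_0, …, X_t, U_0, …, U_{t-1})` under the transition kernel `T` and the
policy `γ`, started from the state `x`. -/
noncomputable def histLaw (T : Kernel (X × U) X) (γ : AdmissiblePolicy X U) (x : X) :
    (t : ℕ) → Measure (History X U t)
  | 0 => Measure.dirac (fun _ => x, Fin.elim0)
  | t + 1 => (histLaw T γ x t ⊗ₘ nextState T γ t).map
      (fun p => (Fin.snoc (α := fun _ => X) p.1.1 p.2,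
        Fin.snoc (α := fun _ => U) p.1.2 (γ.act t p.1)))

/-- The expected total cost `E_x[∑_{t < N} c(X_t, U_t)]`. -/
noncomputable def finiteCost (c : X → U → ℝ) (T : Kernel (X × U) X) (γ : AdmissiblePolicy X U)
    (N : ℕ) (x : X) : ℝ :=
  ∫ h, ∑ t : Fin N, c (h.1 t.castSucc) (h.2 t) ∂(histLaw T γ x N)

/-- The infinite-horizon average cost `J_∞(T, γ, x)`. -/
noncomputable def avgCost (c : X → U → ℝ) (T : Kernel (X × U) X) (γ : AdmissiblePolicy X U)
    (x : X) : ℝ :=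
  limsup (fun N : ℕ => (1 / (N : ℝ)) * finiteCost c T γ N x) atTop

/-- The optimal average cost `J_∞^*(T, x)`, the infimum over all admissible policies. -/
noncomputable def optAvgCost (c : X → U → ℝ) (T : Kernel (X × U) X) (x : X) : ℝ :=
  ⨅ γ : AdmissiblePolicy X U, avgCost c T γ x

/-- The transition kernel `T(· | x, g(x))` under a stationary policy `g`. -/
noncomputable def closedLoop (T : Kernel (X × U) X) (g : StationaryPolicy X U) : Kernel X X :=
  T.comap (fun x => (x, g.act x)) (measurable_id.prodMk g.measurable_act)

/-- The `t`-step transition kernel `T^t(· | x, g)` under a stationary policy `g`. -/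
noncomputable def stepKernel (T : Kernel (X × U) X) (g : StationaryPolicy X U) : ℕ → Kernel X X
  | 0 => Kernel.id
  | t + 1 => closedLoop T g ∘ₖ stepKernel T g t

/-- The total variation distance `sup_{‖f‖_∞ ≤ 1} |∫ f dμ - ∫ f dν|` (with values in `[0,2]` on
probability measures). -/
noncomputable def tvDistance (μ ν : Measure X) : ℝ :=
  sSup {r : ℝ | ∃ f : X → ℝ, Measurable f ∧ (∀ x, |f x| ≤ 1) ∧ r = |∫ x, f x ∂μ - ∫ x, f x ∂ν|}

/-- The ergodicity condition `‖T^t(· | x, g) - T^t(· | x', g)‖_TV ≤ 2β` for all states `x, x'` and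
all stationary policies `g`. -/
def ErgodicityCondition (T : Kernel (X × U) X) (t : ℕ) (β : ℝ) : Prop :=
  ∀ (g : StationaryPolicy X U) (x x' : X),
    tvDistance (stepKernel T g t x) (stepKernel T g t x') ≤ 2 * β

/-- Setwise convergence: convergence of the integrals of all bounded measurable functions. -/
def SetwiseTendsto (μ : ℕ → Measure X) (ν : Measure X) : Prop :=
  ∀ f : X → ℝ, Measurable f → (∃ K : ℝ, ∀ x, |f x| ≤ K) →
    Tendsto (fun n => ∫ x, f x ∂(μ n)) atTop (𝓝 (∫ x, f x ∂ν))

/-- The stationary policy `g` satisfies the average cost optimality equation (ACOE) of the kernel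
`T`: for some constant `j` and some bounded measurable `v`, for all `x`,
`j + v(x) = inf_u (c(x,u) + ∫ v(y) T(dy | x,u)) = c(x,g(x)) + ∫ v(y) T(dy | x,g(x))`. -/
def SatisfiesACOE (c : X → U → ℝ) (T : Kernel (X × U) X) (g : StationaryPolicy X U) : Prop :=
  ∃ (j : ℝ) (v : X → ℝ), Measurable v ∧ (∃ K : ℝ, ∀ x, |v x| ≤ K) ∧
    ∀ x, j + v x = ⨅ u : U, (c x u + ∫ y, v y ∂(T (x, u))) ∧
      j + v x = c x (g.act x) + ∫ y, v y ∂(T (x, g.act x))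

end AvgMDP

/-!
The kernels `S n` approximating `T` need not be regular in the action, so infima over all actions
may fail to be measurable. We take instead Bellman operators over a countable family of stationary
policies: the given `γ n`, and the constant policies of a dense sequence of actions.

Under the ergodicity condition, `k` discounted Bellman iterates started from `0`, with discount
factor near `1`, solve the average cost optimality equation up to `δ`; `k` and the discount factor
depend only on `t`, `β`, `δ` and the cost bound, so they serve all `S n` and `T`. If `v` solves the
equation of `S n` exactly and `w n` is its approximate solution, then `v - w n` is nearly
subharmonic under one policy and nearly superharmonic under another. Switching between the two
policies at the middle of the range of `v - w n` shows that it is nearly constant, so `γ n` is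
nearly greedy for `w n`.

For fixed `k` the functions `w n` converge pointwise to the approximate solution `w` of `T`, and by
compactness their integrals converge uniformly in the action. So `γ n` is nearly greedy for `w`
under `T` up to an error that tends to zero pointwise, though perhaps not uniformly. Replacing that
error by its expectation after finitely many steps makes it nearly constant by ergodicity, hence
harmless for the average cost.
-/

namespace AvgMDP

section BddMeasurable

variable {X Y : Type*} [MeasurableSpace X] [MeasurableSpace Y]

theorem abs_integral_le_of_forall_abs_le (μ : Measure X) [IsProbabilityMeasure μ] {f : X → ℝ}
    {r : ℝ} (h : ∀ x, |f x| ≤ r) : |∫ x, f x ∂μ| ≤ r := by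
  simpa using norm_integral_le_of_norm_le_const (μ := μ) (f := f) (Eventually.of_forall h)

/-- Bounded measurable real functions, the test functions of setwise convergence. -/
structure BddMeasurable (f : X → ℝ) : Prop where
  measurable : Measurable f
  bdd : ∃ C : ℝ, ∀ x, |f x| ≤ C

namespace BddMeasurable

variable {f g : X → ℝ}

theorem const (r : ℝ) : BddMeasurable (fun _ : X => r) :=
  ⟨measurable_const, |r|, fun _ => le_rfl⟩

theorem add (hf : BddMeasurable f) (hg : BddMeasurable g) :
    BddMeasurable (fun x => f x + g x) := by
  obtain ⟨C, hC⟩ := hf.bdd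
  obtain ⟨D, hD⟩ := hg.bdd
  exact ⟨hf.measurable.add hg.measurable, C + D,
    fun x => (abs_add_le _ _).trans (add_le_add (hC x) (hD x))⟩

theorem const_mul (r : ℝ) (hf : BddMeasurable f) : BddMeasurable (fun x => r * f x) := by
  obtain ⟨C, hC⟩ := hf.bdd
  refine ⟨hf.measurable.const_mul r, |r| * C, fun x => ?_⟩
  rw [abs_mul]
  exact mul_le_mul_of_nonneg_left (hC x) (abs_nonneg r)

theorem sub (hf : BddMeasurable f) (hg : BddMeasurable g) :
    BddMeasurable (fun x => f x - g x) := by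
  simpa only [sub_eq_add_neg, neg_one_mul] using hf.add (hg.const_mul (-1))

theorem comp (hf : BddMeasurable f) {φ : Y → X} (hφ : Measurable φ) :
    BddMeasurable (fun y => f (φ y)) :=
  ⟨hf.measurable.comp hφ, hf.bdd.imp fun _ h y => h (φ y)⟩

theorem integrable (hf : BddMeasurable f) (μ : Measure X) [IsFiniteMeasure μ] :
    Integrable f μ := by
  obtain ⟨C, hC⟩ := hf.bdd
  exact Integrable.of_bound hf.measurable.aestronglyMeasurable C (Eventually.of_forall hC)

theorem bddAbove_range (hf : BddMeasurable f) : BddAbove (Set.range f) := by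
  obtain ⟨C, hC⟩ := hf.bdd
  exact ⟨C, Set.forall_mem_range.2 fun x => (abs_le.1 (hC x)).2⟩

theorem bddBelow_range (hf : BddMeasurable f) : BddBelow (Set.range f) := by
  obtain ⟨C, hC⟩ := hf.bdd
  exact ⟨-C, Set.forall_mem_range.2 fun x => (abs_le.1 (hC x)).1⟩

theorem integral_le (hf : BddMeasurable f) {r : ℝ} (h : ∀ x, f x ≤ r) (μ : Measure X)
    [IsProbabilityMeasure μ] : ∫ x, f x ∂μ ≤ r := by
  simpa using integral_mono (hf.integrable μ) (integrable_const r) h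

theorem le_integral (hf : BddMeasurable f) {r : ℝ} (h : ∀ x, r ≤ f x) (μ : Measure X)
    [IsProbabilityMeasure μ] : r ≤ ∫ x, f x ∂μ := by
  simpa using integral_mono (integrable_const r) (hf.integrable μ) h

theorem kernelIntegral (hf : BddMeasurable f) (κ : Kernel Y X) [IsMarkovKernel κ] :
    BddMeasurable (fun y => ∫ x, f x ∂κ y) := by
  obtain ⟨C, hC⟩ := hf.bdd
  exact ⟨(hf.measurable.stronglyMeasurable.integral_kernel (κ := κ)).measurable, C,
    fun y => abs_integral_le_of_forall_abs_le (κ y) hC⟩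

end BddMeasurable

theorem exists_forall_abs_sub_le_half {f : X → ℝ} (hf : BddMeasurable f) {s : ℝ}
    (hs : ∀ x x', f x - f x' ≤ s) : ∃ a, ∀ x, |f x - a| ≤ s / 2 := by
  refine ⟨(⨅ x, f x) + s / 2, fun x => abs_le.2 ⟨?_, ?_⟩⟩
  · linarith [ciInf_le hf.bddBelow_range x]
  · have : Nonempty X := ⟨x⟩
    have : f x - s ≤ ⨅ y, f y := le_ciInf fun y => by linarith [hs x y]
    linarith

theorem integral_sub_integral_le_of_forall_sub_le {f : X → ℝ} (hf : BddMeasurable f) {s : ℝ}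
    (hs : ∀ x x', f x - f x' ≤ s) (μ ν : Measure X) [IsProbabilityMeasure μ]
    [IsProbabilityMeasure ν] : ∫ x, f x ∂μ - ∫ x, f x ∂ν ≤ s := by
  obtain ⟨a, ha⟩ := exists_forall_abs_sub_le_half hf hs
  have hμ : ∫ x, f x ∂μ ≤ a + s / 2 := hf.integral_le (fun x => by linarith [(abs_le.1 (ha x)).2]) μ
  have hν : a - s / 2 ≤ ∫ x, f x ∂ν := hf.le_integral (fun x => by linarith [(abs_le.1 (ha x)).1]) ν
  linarith

end BddMeasurable

section TransitionOp

variable {X U : Type*} [MeasurableSpace X] [MeasurableSpace U] {f g : X → ℝ}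

/-- The action of a transition kernel on functions, `f ↦ ∫ f(y) P(dy | ·)`. -/
noncomputable def transitionOp (P : Kernel X X) (f : X → ℝ) (x : X) : ℝ := ∫ y, f y ∂(P x)

theorem transitionOp_const_mul (P : Kernel X X) (r : ℝ) (f : X → ℝ) (x : X) :
    transitionOp P (fun y => r * f y) x = r * transitionOp P f x :=
  integral_const_mul r f

section Markov

variable (P : Kernel X X) [IsMarkovKernel P]

theorem BddMeasurable.transitionOp (hf : BddMeasurable f) : BddMeasurable (transitionOp P f) :=
  hf.kernelIntegral P

theorem transitionOp_const (r : ℝ) (x : X) : transitionOp P (fun _ => r) x = r := by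
  simp [transitionOp]

theorem transitionOp_mono (hf : BddMeasurable f) (hg : BddMeasurable g) (h : ∀ x, f x ≤ g x)
    (x : X) : transitionOp P f x ≤ transitionOp P g x :=
  integral_mono (hf.integrable _) (hg.integrable _) h

theorem transitionOp_add (hf : BddMeasurable f) (hg : BddMeasurable g) (x : X) :
    transitionOp P (fun y => f y + g y) x = transitionOp P f x + transitionOp P g x :=
  integral_add (hf.integrable _) (hg.integrable _)

theorem transitionOp_sub (hf : BddMeasurable f) (hg : BddMeasurable g) (x : X) :
    transitionOp P (fun y => f y - g y) x = transitionOp P f x - transitionOp P g x :=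
  integral_sub (hf.integrable _) (hg.integrable _)

theorem abs_transitionOp_sub_le (hf : BddMeasurable f) {a r : ℝ} (h : ∀ x, |f x - a| ≤ r)
    (x : X) : |transitionOp P f x - a| ≤ r := by
  have := abs_integral_le_of_forall_abs_le (P x) h
  rwa [integral_sub (hf.integrable _) (integrable_const a), integral_const, probReal_univ,
    one_smul] at this

theorem nonneg_of_forall_le_transitionOp_add [Nonempty X] (hf : BddMeasurable f) {a : ℝ}
    (h : ∀ x, f x ≤ transitionOp P f x + a) : 0 ≤ a := by
  have hsup : ⨆ x, f x ≤ (⨆ x, f x) + a := ciSup_le fun x => (h x).trans <|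
    add_le_add_left (hf.integral_le (fun y => le_ciSup hf.bddAbove_range y) (P x)) a
  linarith

end Markov

instance isMarkovKernel_closedLoop (T : Kernel (X × U) X) [IsMarkovKernel T]
    (g : StationaryPolicy X U) : IsMarkovKernel (closedLoop T g) := by
  unfold closedLoop
  infer_instance

instance isMarkovKernel_stepKernel (T : Kernel (X × U) X) [IsMarkovKernel T]
    (g : StationaryPolicy X U) (k : ℕ) : IsMarkovKernel (stepKernel T g k) := by
  induction k <;> unfold stepKernel <;> infer_instance

theorem transitionOp_stepKernel_zero (T : Kernel (X × U) X) (g : StationaryPolicy X U)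
    (hf : BddMeasurable f) : transitionOp (stepKernel T g 0) f = f := by
  funext x
  simpa only [transitionOp, stepKernel, Kernel.id_apply] using
    integral_dirac' f x hf.measurable.stronglyMeasurable

variable (T : Kernel (X × U) X) [IsMarkovKernel T] (g : StationaryPolicy X U)

theorem transitionOp_stepKernel_succ (hf : BddMeasurable f) (k : ℕ) :
    transitionOp (stepKernel T g (k + 1)) f
      = transitionOp (stepKernel T g k) (transitionOp (closedLoop T g) f) := by
  funext x
  exact Kernel.integral_comp (hf.integrable _)

theorem transitionOp_stepKernel_add (hf : BddMeasurable f) (k m : ℕ) :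
    transitionOp (stepKernel T g (k + m)) f
      = transitionOp (stepKernel T g k) (transitionOp (stepKernel T g m) f) := by
  induction m generalizing f with
  | zero => rw [add_zero, transitionOp_stepKernel_zero T g hf]
  | succ m ih =>
    rw [← add_assoc, transitionOp_stepKernel_succ T g hf, ih (hf.transitionOp _),
      transitionOp_stepKernel_succ T g hf m]

theorem transitionOp_stepKernel_succ' (hf : BddMeasurable f) (k : ℕ) :
    transitionOp (stepKernel T g (k + 1)) f
      = transitionOp (closedLoop T g) (transitionOp (stepKernel T g k) f) := by
  rw [add_comm, transitionOp_stepKernel_add T g hf,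
    transitionOp_stepKernel_succ T g (hf.transitionOp _),
    transitionOp_stepKernel_zero T g ((hf.transitionOp _).transitionOp _)]

theorem transitionOp_stepKernel_le_pow_mul (hf : BddMeasurable f) {r : ℝ} (hr : 0 ≤ r)
    (h : ∀ x, transitionOp (closedLoop T g) f x ≤ r * f x) (k : ℕ) (x : X) :
    transitionOp (stepKernel T g k) f x ≤ r ^ k * f x := by
  induction k with
  | zero => simp [transitionOp_stepKernel_zero T g hf]
  | succ k ih =>
    calc transitionOp (stepKernel T g (k + 1)) f x
        = transitionOp (stepKernel T g k) (transitionOp (closedLoop T g) f) x := by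
          rw [transitionOp_stepKernel_succ T g hf]
      _ ≤ transitionOp (stepKernel T g k) (fun y => r * f y) x :=
          transitionOp_mono _ (hf.transitionOp _) (hf.const_mul r) h x
      _ = r * transitionOp (stepKernel T g k) f x := transitionOp_const_mul _ r f x
      _ ≤ r * (r ^ k * f x) := mul_le_mul_of_nonneg_left ih hr
      _ = r ^ (k + 1) * f x := by ring

end TransitionOp

section Contraction

variable {X U : Type*} [MeasurableSpace X] [MeasurableSpace U]

theorem tvDistance_nonneg (μ ν : Measure X) : 0 ≤ tvDistance μ ν :=
  Real.sSup_nonneg (by rintro _ ⟨f, -, -, rfl⟩; exact abs_nonneg _)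

theorem abs_integral_sub_integral_le_mul_tvDistance (μ ν : Measure X) [IsProbabilityMeasure μ]
    [IsProbabilityMeasure ν] {f : X → ℝ} (hf : Measurable f) {r : ℝ} (hr : ∀ x, |f x| ≤ r) :
    |∫ x, f x ∂μ - ∫ x, f x ∂ν| ≤ r * tvDistance μ ν := by
  have : Nonempty X := nonempty_of_isProbabilityMeasure μ
  have hr0 : 0 ≤ r := (abs_nonneg _).trans (hr (Classical.arbitrary X))
  rcases hr0.eq_or_lt with rfl | hr0
  · simp [funext fun x => abs_nonpos_iff.1 (hr x)]
  have hbdd : BddAbove {s : ℝ | ∃ f : X → ℝ, Measurable f ∧ (∀ x, |f x| ≤ 1) ∧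
      s = |∫ x, f x ∂μ - ∫ x, f x ∂ν|} := by
    refine ⟨1 + 1, ?_⟩
    rintro _ ⟨f, -, hf1, rfl⟩
    exact (abs_sub _ _).trans (add_le_add (abs_integral_le_of_forall_abs_le μ hf1)
      (abs_integral_le_of_forall_abs_le ν hf1))
  have hle : |∫ x, r⁻¹ * f x ∂μ - ∫ x, r⁻¹ * f x ∂ν| ≤ tvDistance μ ν := by
    refine le_csSup hbdd ⟨_, hf.const_mul r⁻¹, fun x => ?_, rfl⟩
    rw [abs_mul, abs_inv, abs_of_pos hr0, inv_mul_le_one₀ hr0]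
    exact hr x
  rwa [integral_const_mul, integral_const_mul, ← mul_sub, abs_mul, abs_inv, abs_of_pos hr0,
    inv_mul_le_iff₀ hr0] at hle

theorem abs_integral_sub_integral_le_half_mul_tvDistance (μ ν : Measure X)
    [IsProbabilityMeasure μ] [IsProbabilityMeasure ν] {f : X → ℝ} (hf : BddMeasurable f) {s : ℝ}
    (hs : ∀ x x', f x - f x' ≤ s) :
    |∫ x, f x ∂μ - ∫ x, f x ∂ν| ≤ s / 2 * tvDistance μ ν := by
  obtain ⟨a, ha⟩ := exists_forall_abs_sub_le_half hf hs
  have h := abs_integral_sub_integral_le_mul_tvDistance μ ν (hf.measurable.sub_const a) ha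
  rw [integral_sub (hf.integrable μ) (integrable_const a),
    integral_sub (hf.integrable ν) (integrable_const a)] at h
  simpa using h

namespace ErgodicityCondition

variable {T : Kernel (X × U) X} {t : ℕ} {β : ℝ} (hT : ErgodicityCondition T t β)
  (g : StationaryPolicy X U) {f : X → ℝ} {s : ℝ}

include hT g

theorem nonneg [Nonempty X] : 0 ≤ β := by
  have x := Classical.arbitrary X
  linarith [hT g x x, tvDistance_nonneg (stepKernel T g t x) (stepKernel T g t x)]

variable [IsMarkovKernel T]

theorem transitionOp_sub_le (hf : BddMeasurable f) (hs : ∀ x x', f x - f x' ≤ s) (x x' : X) :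
    transitionOp (stepKernel T g t) f x - transitionOp (stepKernel T g t) f x' ≤ β * s := by
  have hs0 : 0 ≤ s := by simpa using hs x x
  calc _ ≤ s / 2 * tvDistance (stepKernel T g t x) (stepKernel T g t x') :=
        (le_abs_self _).trans (abs_integral_sub_integral_le_half_mul_tvDistance _ _ hf hs)
    _ ≤ s / 2 * (2 * β) := by gcongr; exact hT g x x'
    _ = β * s := by ring

theorem transitionOp_mul_sub_le (hf : BddMeasurable f) (hs : ∀ x x', f x - f x' ≤ s) (p : ℕ)
    (x x' : X) :
    transitionOp (stepKernel T g (t * p)) f x - transitionOp (stepKernel T g (t * p)) f x'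
      ≤ β ^ p * s := by
  induction p generalizing x x' with
  | zero => simpa [transitionOp_stepKernel_zero T g hf] using hs x x'
  | succ p ih =>
    rw [mul_add_one, add_comm (t * p), transitionOp_stepKernel_add T g hf]
    calc _ ≤ β * (β ^ p * s) := hT.transitionOp_sub_le g (hf.transitionOp _) ih x x'
      _ = β ^ (p + 1) * s := by ring

end ErgodicityCondition

end Contraction

section Merging

variable {X U : Type*} [MeasurableSpace X] [MeasurableSpace U]

/-- The stationary policy that follows `g` on the set `s` and `g'` elsewhere. -/
noncomputable def StationaryPolicy.piecewise {s : Set X} (hs : MeasurableSet s)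
    (g g' : StationaryPolicy X U) : StationaryPolicy X U where
  act := by classical exact s.piecewise g.act g'.act
  measurable_act := by classical exact g.measurable_act.piecewise hs g'.measurable_act

theorem StationaryPolicy.piecewise_act_of_mem {s : Set X} (hs : MeasurableSet s)
    (g g' : StationaryPolicy X U) {x : X} (hx : x ∈ s) : (piecewise hs g g').act x = g.act x := by
  classical exact Set.piecewise_eq_of_mem _ _ _ hx

theorem StationaryPolicy.piecewise_act_of_notMem {s : Set X} (hs : MeasurableSet s)
    (g g' : StationaryPolicy X U) {x : X} (hx : x ∉ s) :
    (piecewise hs g g').act x = g'.act x := by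
  classical exact Set.piecewise_eq_of_notMem _ _ _ hx

theorem transitionOp_closedLoop_congr (T : Kernel (X × U) X) {g g' : StationaryPolicy X U} {x : X}
    (h : g.act x = g'.act x) (f : X → ℝ) :
    transitionOp (closedLoop T g) f x = transitionOp (closedLoop T g') f x := by
  simp only [transitionOp, closedLoop, Kernel.comap_apply, h]

variable (T : Kernel (X × U) X) [IsMarkovKernel T] {t : ℕ} {β : ℝ} {g g' : StationaryPolicy X U}
  {f : X → ℝ} {κ : ℝ}

theorem transitionOp_closedLoop_le_two_mul {q : StationaryPolicy X U} (hf : BddMeasurable f)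
    {W : ℝ} (hW : ∀ x, f x ≤ W) (hg : ∀ x, transitionOp (closedLoop T g) f x ≤ 2 * f x)
    (hq : ∀ x, q.act x = g.act x ∨ W ≤ 2 * f x) (x : X) :
    transitionOp (closedLoop T q) f x ≤ 2 * f x := by
  rcases hq x with h | h
  · exact (transitionOp_closedLoop_congr T h f).trans_le (hg x)
  · exact (hf.integral_le hW _).trans h

/-- Follow `g` where `f` is in the upper half of its range `[b, A]` and `g'` where it is in the
lower half: then both `A - f + κ` and `f - b + κ` at most double in expectation at each step. -/
theorem exists_policy_transitionOp_le_two_mul (hf : BddMeasurable f) (hκ : 0 ≤ κ)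
    (hg : ∀ x, f x ≤ transitionOp (closedLoop T g) f x + κ)
    (hg' : ∀ x, transitionOp (closedLoop T g') f x ≤ f x + κ) {A b : ℝ} (hA : ∀ x, f x ≤ A)
    (hb : ∀ x, b ≤ f x) :
    ∃ q : StationaryPolicy X U,
      (∀ x, transitionOp (closedLoop T q) (fun y => A + κ - f y) x ≤ 2 * (A + κ - f x)) ∧
      ∀ x, transitionOp (closedLoop T q) (fun y => f y - (b - κ)) x ≤ 2 * (f x - (b - κ)) := by
  have hs : MeasurableSet {x | (A + b) / 2 ≤ f x} := measurableSet_le measurable_const hf.measurable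
  refine ⟨.piecewise hs g g', ?_, ?_⟩
  · refine transitionOp_closedLoop_le_two_mul T (g := g) ((BddMeasurable.const _).sub hf)
      (W := A - b + κ) (fun x => by linarith [hb x]) (fun x => ?_) fun x => ?_
    · rw [transitionOp_sub _ (.const _) hf, transitionOp_const]
      linarith [hg x, hA x]
    · refine (em ((A + b) / 2 ≤ f x)).imp (StationaryPolicy.piecewise_act_of_mem hs g g')
        fun h => ?_
      linarith
  · refine transitionOp_closedLoop_le_two_mul T (g := g') (hf.sub (.const _))
      (W := A - b + κ) (fun x => by linarith [hA x]) (fun x => ?_) fun x => ?_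
    · rw [transitionOp_sub _ hf (.const _), transitionOp_const]
      linarith [hg' x, hb x]
    · refine (em ((A + b) / 2 ≤ f x)).symm.imp (StationaryPolicy.piecewise_act_of_notMem hs g g')
        fun h => ?_
      linarith

variable {T} (hT : ErgodicityCondition T t β)

include hT

theorem ErgodicityCondition.le_two_pow_mul_of_forall_mem_Icc (hf : BddMeasurable f) (hκ : 0 ≤ κ)
    (hg : ∀ x, f x ≤ transitionOp (closedLoop T g) f x + κ)
    (hg' : ∀ x, transitionOp (closedLoop T g') f x ≤ f x + κ) {A b : ℝ} (hA : ∀ x, f x ≤ A)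
    (hb : ∀ x, b ≤ f x) (x x' : X) :
    (1 - β) * (A - b) + 2 * κ ≤ 2 ^ t * (A - b + 2 * κ - (f x - f x')) := by
  obtain ⟨q, hupper, hlower⟩ := exists_policy_transitionOp_le_two_mul T hf hκ hg hg' hA hb
  have hx := transitionOp_stepKernel_le_pow_mul T q ((BddMeasurable.const (A + κ)).sub hf)
    zero_le_two hupper t x
  have hx' := transitionOp_stepKernel_le_pow_mul T q (hf.sub (.const (b - κ)))
    zero_le_two hlower t x'
  rw [transitionOp_sub _ (.const _) hf, transitionOp_const] at hx
  rw [transitionOp_sub _ hf (.const _), transitionOp_const] at hx'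
  have hmix := hT.transitionOp_sub_le q hf (s := A - b)
    (fun y y' => by linarith [hA y, hb y']) x x'
  linarith

theorem ErgodicityCondition.sub_le_of_subharmonic_of_superharmonic (hβ : β < 1)
    (hf : BddMeasurable f) (hκ : 0 ≤ κ)
    (hg : ∀ x, f x ≤ transitionOp (closedLoop T g) f x + κ)
    (hg' : ∀ x, transitionOp (closedLoop T g') f x ≤ f x + κ) (x x' : X) :
    f x - f x' ≤ 2 ^ (t + 1) / (1 - β) * κ := by
  have : Nonempty X := ⟨x⟩
  set A := ⨆ y, f y
  set b := ⨅ y, f y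
  have hA : ∀ y, f y ≤ A := le_ciSup hf.bddAbove_range
  have hb : ∀ y, b ≤ f y := ciInf_le hf.bddBelow_range
  have hpow : (0 : ℝ) < 2 ^ t := by positivity
  have hosc (y y' : X) : f y - f y' ≤ A - b + 2 * κ - ((1 - β) * (A - b) + 2 * κ) / 2 ^ t := by
    rw [le_sub_comm, div_le_iff₀' hpow]
    exact hT.le_two_pow_mul_of_forall_mem_Icc hf hκ hg hg' hA hb y y'
  have hAb : A - b ≤ A - b + 2 * κ - ((1 - β) * (A - b) + 2 * κ) / 2 ^ t := by
    rw [sub_le_comm]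
    refine le_ciInf fun y' => ?_
    rw [sub_le_comm, sub_le_iff_le_add]
    exact ciSup_le fun y => by linarith [hosc y y']
  have hwidth : (1 - β) * (A - b) ≤ 2 ^ (t + 1) * κ := by
    have : ((1 - β) * (A - b) + 2 * κ) / 2 ^ t ≤ 2 * κ := by linarith
    rw [div_le_iff₀ hpow] at this
    rw [pow_succ]
    linarith
  rw [div_mul_eq_mul_div, le_div_iff₀' (sub_pos.2 hβ)]
  exact (mul_le_mul_of_nonneg_left (by linarith [hA x, hb x']) (sub_pos.2 hβ).le).trans hwidth

theorem ErgodicityCondition.sub_le_of_approx_poisson (hβ : β < 1) (hf : BddMeasurable f) {a : ℝ}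
    (hg : ∀ x, f x ≤ transitionOp (closedLoop T g) f x + a + κ)
    (hg' : ∀ x, transitionOp (closedLoop T g') f x + a ≤ f x + κ) (x x' : X) :
    f x - f x' ≤ 2 ^ (t + 2) / (1 - β) * κ := by
  have : Nonempty X := ⟨x⟩
  have ha : 0 ≤ a + κ := nonneg_of_forall_le_transitionOp_add (closedLoop T g) hf
    fun y => by linarith [hg y]
  have ha' : 0 ≤ κ - a := by
    refine nonneg_of_forall_le_transitionOp_add (closedLoop T g') (hf.const_mul (-1)) fun y => ?_
    rw [transitionOp_const_mul]
    linarith [hg' y]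
  refine (hT.sub_le_of_subharmonic_of_superharmonic hβ hf (κ := 2 * κ) (by linarith)
    (fun y => (hg y).trans (by linarith)) (fun y => by linarith [hg' y]) x x').trans_eq ?_
  ring

end Merging

section Bellman

theorem ciInf_le_ciInf_add {ι : Type*} [Nonempty ι] {F G : ι → ℝ} (hF : BddBelow (Set.range F))
    {r : ℝ} (h : ∀ i, F i ≤ G i + r) : ⨅ i, F i ≤ (⨅ i, G i) + r :=
  sub_le_iff_le_add.1 <| le_ciInf fun i => sub_le_iff_le_add.2 <| (ciInf_le hF i).trans (h i)

theorem abs_ciInf_sub_ciInf_sub_le {ι : Type*} [Nonempty ι] {F G : ι → ℝ}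
    (hF : BddBelow (Set.range F)) (hG : BddBelow (Set.range G)) {a r : ℝ}
    (h : ∀ i, |F i - G i - a| ≤ r) : |(⨅ i, F i) - (⨅ i, G i) - a| ≤ r := by
  have hle := ciInf_le_ciInf_add (G := G) hF (r := a + r) fun i => by linarith [(abs_le.1 (h i)).2]
  have hge := ciInf_le_ciInf_add (G := F) hG (r := r - a) fun i => by linarith [(abs_le.1 (h i)).1]
  exact abs_le.2 ⟨by linarith, by linarith⟩

variable {X U ι : Type*} [MeasurableSpace X] [MeasurableSpace U]

/-- The cost of one step under the stationary policy `g` followed by the terminal cost `w`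
discounted by `α`. -/
noncomputable def policyBackup (c : X → U → ℝ) (T : Kernel (X × U) X) (α : ℝ)
    (g : StationaryPolicy X U) (w : X → ℝ) (x : X) : ℝ :=
  c x (g.act x) + α * transitionOp (closedLoop T g) w x

/-- The Bellman operator with discount factor `α`, with the infimum restricted to a family of
stationary policies: for a countable family it preserves measurability without any regularity of
`T` in the action. -/
noncomputable def bellman (c : X → U → ℝ) (T : Kernel (X × U) X) (G : ι → StationaryPolicy X U)
    (α : ℝ) (w : X → ℝ) (x : X) : ℝ :=
  ⨅ i, policyBackup c T α (G i) w x

variable {c : X → U → ℝ} (hc : BddMeasurable (Function.uncurry c)) {T : Kernel (X × U) X}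
  [IsMarkovKernel T] {G : ι → StationaryPolicy X U} {α K : ℝ} {w w' : X → ℝ}

theorem abs_policyBackup_le (hK : ∀ x u, |c x u| ≤ K) (hα : 0 ≤ α) {C : ℝ} (hC : ∀ x, |w x| ≤ C)
    (g : StationaryPolicy X U) (x : X) : |policyBackup c T α g w x| ≤ K + α * C := by
  refine (abs_add_le _ _).trans (add_le_add (hK _ _) ?_)
  rw [abs_mul, abs_of_nonneg hα]
  exact mul_le_mul_of_nonneg_left (abs_integral_le_of_forall_abs_le _ hC) hα

theorem abs_bellman_le [Nonempty ι] (hK : ∀ x u, |c x u| ≤ K) (hα : 0 ≤ α) {C : ℝ}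
    (hC : ∀ x, |w x| ≤ C) (x : X) : |bellman c T G α w x| ≤ K + α * C := by
  have hle (i : ι) := abs_le.1 (abs_policyBackup_le (T := T) hK hα hC (G i) x)
  have hbdd : BddBelow (Set.range fun i => policyBackup c T α (G i) w x) :=
    ⟨-(K + α * C), by rintro _ ⟨i, rfl⟩; exact (hle i).1⟩
  exact abs_le.2 ⟨le_ciInf fun i => (hle i).1,
    (ciInf_le hbdd (Classical.arbitrary ι)).trans (hle _).2⟩

include hc in
theorem BddMeasurable.policyBackup (hw : BddMeasurable w) (g : StationaryPolicy X U) :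
    BddMeasurable (policyBackup c T α g w) :=
  (hc.comp (measurable_id.prodMk g.measurable_act)).add ((hw.transitionOp _).const_mul α)

include hc in
theorem bddBelow_range_policyBackup (hw : BddMeasurable w) (x : X) :
    BddBelow (Set.range fun i => policyBackup c T α (G i) w x) :=
  (hc.add ((hw.kernelIntegral T).const_mul α)).bddBelow_range.mono
    (by rintro _ ⟨i, rfl⟩; exact ⟨(x, (G i).act x), rfl⟩)

include hc in
theorem bellman_le_policyBackup (hw : BddMeasurable w) (i : ι) (x : X) :
    bellman c T G α w x ≤ policyBackup c T α (G i) w x :=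
  ciInf_le (bddBelow_range_policyBackup hc hw x) i

variable [Nonempty ι]

include hc in
theorem abs_bellman_sub_bellman_le (hα : 0 ≤ α) (hw : BddMeasurable w) (hw' : BddMeasurable w')
    {s : ℝ} (h : ∀ x, |w x - w' x| ≤ s) (x : X) :
    |bellman c T G α w x - bellman c T G α w' x| ≤ α * s := by
  have hbackup (i : ι) :
      |policyBackup c T α (G i) w x - policyBackup c T α (G i) w' x - 0| ≤ α * s := by
    rw [sub_zero, policyBackup, policyBackup, add_sub_add_left_eq_sub, ← mul_sub,
      ← transitionOp_sub _ hw hw', abs_mul, abs_of_nonneg hα]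
    exact mul_le_mul_of_nonneg_left (abs_integral_le_of_forall_abs_le _ h) hα
  rw [← sub_zero (_ - _)]
  exact abs_ciInf_sub_ciInf_sub_le (bddBelow_range_policyBackup hc hw x)
    (bddBelow_range_policyBackup hc hw' x) hbackup

include hc in
theorem abs_bellman_one_sub_bellman_le (hα1 : α ≤ 1) (hw : BddMeasurable w) {M : ℝ}
    (hM : ∀ x x', w x - w x' ≤ M) (x₀ x : X) :
    |bellman c T G 1 w x - bellman c T G α w x - (1 - α) * w x₀| ≤ (1 - α) * M := by
  have hα0 : 0 ≤ 1 - α := sub_nonneg.2 hα1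
  refine abs_ciInf_sub_ciInf_sub_le (bddBelow_range_policyBackup hc hw x)
    (bddBelow_range_policyBackup hc hw x) fun i => ?_
  calc |policyBackup c T 1 (G i) w x - policyBackup c T α (G i) w x - (1 - α) * w x₀|
      = |(1 - α) * (transitionOp (closedLoop T (G i)) w x - w x₀)| := by
        unfold policyBackup
        ring_nf
    _ = (1 - α) * |transitionOp (closedLoop T (G i)) w x - w x₀| := by
        rw [abs_mul, abs_of_nonneg hα0]
    _ ≤ (1 - α) * M := mul_le_mul_of_nonneg_left
        (abs_transitionOp_sub_le _ hw (fun y => abs_sub_le_iff.2 ⟨hM y x₀, hM x₀ y⟩) x) hα0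

theorem abs_bellman_iterate_le (hK : ∀ x u, |c x u| ≤ K) (hα : 0 ≤ α) (hα1 : α < 1) (k : ℕ)
    (x : X) : |(bellman c T G α)^[k] 0 x| ≤ K / (1 - α) := by
  have hα' : 0 < 1 - α := sub_pos.2 hα1
  induction k generalizing x with
  | zero =>
    have hK0 : 0 ≤ K := (abs_nonneg _).trans (hK x ((G (Classical.arbitrary ι)).act x))
    simpa using div_nonneg hK0 hα'.le
  | succ k ih =>
    rw [Function.iterate_succ_apply']
    refine (abs_bellman_le hK hα ih x).trans_eq ?_
    field_simp
    ring

variable [Countable ι]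

include hc in
theorem BddMeasurable.bellman (hw : BddMeasurable w) : BddMeasurable (bellman c T G α w) := by
  obtain ⟨C, hC⟩ := (hc.add ((hw.kernelIntegral T).const_mul α)).bdd
  have hCi (i : ι) (x : X) := abs_le.1 (hC (x, (G i).act x))
  exact ⟨.iInf fun i => (hc.policyBackup hw (G i)).measurable, C, fun x => abs_le.2
    ⟨le_ciInf fun i => (hCi i x).1,
      (bellman_le_policyBackup hc hw (Classical.arbitrary ι) x).trans (hCi _ x).2⟩⟩

include hc in
theorem bddMeasurable_bellman_iterate (k : ℕ) : BddMeasurable ((bellman c T G α)^[k] 0) := by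
  induction k with
  | zero => exact .const 0
  | succ k ih =>
    rw [Function.iterate_succ_apply']
    exact hc.bellman ih

include hc in
theorem abs_bellman_iterate_succ_sub_le (hK : ∀ x u, |c x u| ≤ K) (hα : 0 ≤ α) (k : ℕ) (x : X) :
    |(bellman c T G α)^[k + 1] 0 x - (bellman c T G α)^[k] 0 x| ≤ α ^ k * K := by
  induction k generalizing x with
  | zero =>
    simpa using abs_bellman_le (T := T) (G := G) (w := 0) hK hα (C := 0) (fun _ => by simp) x
  | succ k ih =>
    have hw (m : ℕ) : BddMeasurable ((bellman c T G α)^[m] 0) := bddMeasurable_bellman_iterate hc m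
    have hstep := abs_bellman_sub_bellman_le (T := T) (G := G) hc hα (hw (k + 1)) (hw k) ih x
    rwa [← Function.iterate_succ_apply' (bellman c T G α),
      ← Function.iterate_succ_apply' (bellman c T G α), ← mul_assoc, ← pow_succ'] at hstep

include hc in
theorem exists_policyBackup_mem_Icc_bellman (hw : BddMeasurable w) {ε : ℝ} (hε : 0 < ε) :
    ∃ g : StationaryPolicy X U, ∀ x, policyBackup c T α g w x ∈
      Set.Icc (bellman c T G α w x) (bellman c T G α w x + ε) := by
  classical
  obtain ⟨e, he⟩ := exists_surjective_nat ι
  have hex (x : X) : ∃ n, policyBackup c T α (G (e n)) w x ≤ bellman c T G α w x + ε := by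
    obtain ⟨i, hi⟩ := exists_lt_of_ciInf_lt (lt_add_of_pos_right (bellman c T G α w x) hε)
    obtain ⟨n, rfl⟩ := he i
    exact ⟨n, hi.le⟩
  have hmeas (n : ℕ) :
      MeasurableSet {x | policyBackup c T α (G (e n)) w x ≤ bellman c T G α w x + ε} :=
    measurableSet_le (hc.policyBackup hw _).measurable ((hc.bellman hw).measurable.add_const ε)
  exact ⟨⟨fun x => (G (e (Nat.find (hex x)))).act x,
    Measurable.find (fun n => (G (e n)).measurable_act) hmeas hex⟩,
    fun x => ⟨bellman_le_policyBackup hc hw (e (Nat.find (hex x))) x, Nat.find_spec (hex x)⟩⟩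

/-- Near-greedy policies move the discounted iterate little, so it is nearly constant up to a
bound that does not depend on the discount factor. -/
theorem ErgodicityCondition.bellman_iterate_sub_le {t : ℕ} {β : ℝ}
    (hT : ErgodicityCondition T t β) (hβ : β < 1) (hc : Measurable (Function.uncurry c))
    (hK : ∀ x u, |c x u| ≤ K) (hα : 0 ≤ α) (hα1 : α < 1) (k : ℕ) (x x' : X) :
    (bellman c T G α)^[k] 0 x - (bellman c T G α)^[k] 0 x'
      ≤ 2 ^ (t + 1) / (1 - β) * (3 * K + 1) := by
  have hc' : BddMeasurable (Function.uncurry c) := ⟨hc, K, fun p => hK p.1 p.2⟩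
  have hK0 : 0 ≤ K := (abs_nonneg _).trans (hK x ((G (Classical.arbitrary ι)).act x))
  set w := (bellman c T G α)^[k] 0
  have hw : BddMeasurable w := bddMeasurable_bellman_iterate hc' k
  obtain ⟨g, hg⟩ := exists_policyBackup_mem_Icc_bellman hc' (T := T) (G := G) (α := α) hw one_pos
  have hdefect (y : X) : |transitionOp (closedLoop T g) w y - w y| ≤ 3 * K + 1 := by
    have hiter : |bellman c T G α w y - w y| ≤ K := by
      have := abs_bellman_iterate_succ_sub_le (T := T) (G := G) hc' hK hα k y
      rw [Function.iterate_succ_apply'] at this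
      exact this.trans (mul_le_of_le_one_left hK0 (pow_le_one₀ hα hα1.le))
    have hdisc : |(1 - α) * transitionOp (closedLoop T g) w y| ≤ K := by
      rw [abs_mul, abs_of_pos (sub_pos.2 hα1), ← le_div_iff₀' (sub_pos.2 hα1)]
      exact abs_integral_le_of_forall_abs_le _ (abs_bellman_iterate_le hK hα hα1 k)
    have hstep := abs_le.1 hiter
    have hcost := abs_le.1 (hK y (g.act y))
    obtain ⟨hlower, hupper⟩ := hg y
    unfold policyBackup at hlower hupper
    rw [abs_le] at hdisc ⊢
    constructor <;> linarith
  have hκ : 0 ≤ 3 * K + 1 := by positivity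
  exact hT.sub_le_of_subharmonic_of_superharmonic hβ hw hκ
    (fun y => by linarith [(abs_sub_le_iff.1 (hdefect y)).2])
    (fun y => by linarith [(abs_sub_le_iff.1 (hdefect y)).1]) x x'

/-- The vanishing discount method with a number of iterations and a discount factor that depend
only on the ergodicity constants, hence serve all kernels at once. -/
theorem exists_forall_bellman_iterate_approx_acoe [Nonempty X] (t : ℕ) {β : ℝ} (hβ : β < 1)
    (hc : BddMeasurable (Function.uncurry c)) (G : ι → StationaryPolicy X U) {δ : ℝ} (hδ : 0 < δ) :
    ∃ α : ℝ, 0 ≤ α ∧ ∃ k : ℕ, ∀ (T : Kernel (X × U) X) [IsMarkovKernel T],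
      ErgodicityCondition T t β → ∃ j : ℝ, ∀ x,
        |bellman c T G 1 ((bellman c T G α)^[k] 0) x - (bellman c T G α)^[k] 0 x - j| ≤ δ := by
  have x₀ : X := Classical.arbitrary X
  obtain ⟨K, hcK⟩ := hc.bdd
  have hK (x : X) (u : U) : |c x u| ≤ K := hcK (x, u)
  have hK0 : 0 ≤ K := (abs_nonneg _).trans (hK x₀ ((G (Classical.arbitrary ι)).act x₀))
  set M : ℝ := 2 ^ (t + 1) / (1 - β) * (3 * K + 1)
  have hM0 : 0 ≤ M := by have := sub_pos.2 hβ; positivity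
  obtain ⟨α, hα, hα1, hαM⟩ : ∃ α : ℝ, 0 ≤ α ∧ α < 1 ∧ (1 - α) * M ≤ δ / 2 := by
    refine ⟨1 - δ / (2 * (M + δ)), ?_, ?_, ?_⟩
    · rw [sub_nonneg, div_le_one (by positivity)]
      linarith
    · rw [sub_lt_self_iff]
      positivity
    · rw [sub_sub_cancel, div_mul_eq_mul_div, div_le_div_iff₀ (by positivity) two_pos]
      nlinarith
  obtain ⟨k, hk⟩ := exists_pow_lt_of_lt_one (show 0 < δ / (2 * (K + 1)) by positivity) hα1
  have hkK : α ^ k * K ≤ δ / 2 := by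
    have := (lt_div_iff₀ (by positivity)).1 hk
    nlinarith [pow_nonneg hα k]
  refine ⟨α, hα, k, fun T _ hT => ?_⟩
  set w := (bellman c T G α)^[k] 0
  have hw : BddMeasurable w := bddMeasurable_bellman_iterate hc k
  refine ⟨(1 - α) * w x₀, fun x => ?_⟩
  have hundiscount := abs_bellman_one_sub_bellman_le (T := T) (G := G) hc hα1.le hw
    (hT.bellman_iterate_sub_le hβ hc.measurable hK hα hα1 k) x₀ x
  have hstep := abs_bellman_iterate_succ_sub_le (T := T) (G := G) hc hK hα k x
  rw [Function.iterate_succ_apply'] at hstep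
  rw [abs_le] at hundiscount hstep ⊢
  constructor <;> linarith

/-- `v - w` is nearly subharmonic for a policy that is nearly greedy for `w` and nearly
superharmonic for the greedy policy of `v`. -/
theorem ErgodicityCondition.sub_sub_sub_le_of_acoe {t : ℕ} {β : ℝ}
    (hT : ErgodicityCondition T t β) (hβ : β < 1) (hc : BddMeasurable (Function.uncurry c)) {i : ι}
    {v : X → ℝ} (hv : BddMeasurable v) {jv : ℝ}
    (hle : ∀ g x, jv + v x ≤ policyBackup c T 1 g v x)
    (heq : ∀ x, jv + v x = policyBackup c T 1 (G i) v x) (hw : BddMeasurable w) {j δ : ℝ}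
    (hδ : 0 < δ) (hj : ∀ x, |bellman c T G 1 w x - w x - j| ≤ δ) (x x' : X) :
    (v x - w x) - (v x' - w x') ≤ 2 ^ (t + 3) / (1 - β) * δ := by
  obtain ⟨g, hg⟩ := exists_policyBackup_mem_Icc_bellman hc (T := T) (G := G) (α := 1) hw hδ
  have hsub (y : X) : v y - w y
      ≤ transitionOp (closedLoop T g) (fun z => v z - w z) y + (j - jv) + 2 * δ := by
    have hgreedy := (hg y).2
    have hv_le := hle g y
    unfold policyBackup at hgreedy hv_le
    rw [transitionOp_sub _ hv hw]
    linarith [(abs_le.1 (hj y)).2]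
  have hsuper (y : X) : transitionOp (closedLoop T (G i)) (fun z => v z - w z) y + (j - jv)
      ≤ v y - w y + 2 * δ := by
    have hw_le := bellman_le_policyBackup (T := T) (G := G) (α := 1) hc hw i y
    have hv_eq := heq y
    unfold policyBackup at hw_le hv_eq
    rw [transitionOp_sub _ hv hw]
    linarith [(abs_le.1 (hj y)).1]
  refine (hT.sub_le_of_approx_poisson hβ (hv.sub hw) hsub hsuper x x').trans_eq ?_
  ring

theorem SatisfiesACOE.policyBackup_le_bellman_add {t : ℕ} {β : ℝ}
    (hT : ErgodicityCondition T t β) (hβ : β < 1) (hc : BddMeasurable (Function.uncurry c))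
    {i : ι} (hγ : SatisfiesACOE c T (G i)) (hw : BddMeasurable w) {j δ : ℝ} (hδ : 0 < δ)
    (hj : ∀ x, |bellman c T G 1 w x - w x - j| ≤ δ) (x : X) :
    policyBackup c T 1 (G i) w x ≤ bellman c T G 1 w x + 2 ^ (t + 3) / (1 - β) * δ := by
  obtain ⟨jv, v, hv_meas, hv_bdd, hacoe⟩ := hγ
  have hv : BddMeasurable v := ⟨hv_meas, hv_bdd⟩
  have hle (g : StationaryPolicy X U) (y : X) : jv + v y ≤ policyBackup c T 1 g v y := by
    rw [(hacoe y).1, policyBackup, one_mul]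
    refine ciInf_le ((hc.add (hv.kernelIntegral T)).bddBelow_range.mono ?_) (g.act y)
    rintro _ ⟨u, rfl⟩
    exact ⟨(y, u), rfl⟩
  have heq (y : X) : jv + v y = policyBackup c T 1 (G i) v y := by
    rw [policyBackup, one_mul]
    exact (hacoe y).2
  have hosc := hT.sub_sub_sub_le_of_acoe hβ hc hv hle heq hw hδ hj
  rw [← sub_le_iff_le_add]
  refine le_ciInf fun i' => ?_
  have hmix : transitionOp (closedLoop T (G i')) (fun y => v y - w y) x
      - transitionOp (closedLoop T (G i)) (fun y => v y - w y) x ≤ 2 ^ (t + 3) / (1 - β) * δ :=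
    integral_sub_integral_le_of_forall_sub_le (hv.sub hw) hosc _ _
  rw [transitionOp_sub _ hv hw, transitionOp_sub _ hv hw] at hmix
  have hv_eq := heq x
  have hv_le := hle (G i') x
  unfold policyBackup at hv_eq hv_le ⊢
  linarith

end Bellman

section ContinuousConvergence

variable {U : Type*} [TopologicalSpace U] [FirstCountableTopology U] {F : ℕ → U → ℝ} {f : U → ℝ}

theorem tendsto_extend_strictMono {V : Type*} [TopologicalSpace V] {σ : ℕ → ℕ} (hσ : StrictMono σ)
    {v : ℕ → V} {u : V} (hv : Tendsto v atTop (𝓝 u)) :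
    Tendsto (Function.extend σ v fun _ => u) atTop (𝓝 u) := by
  intro W hW
  obtain ⟨N, hN⟩ := eventually_atTop.1 (hv hW)
  refine mem_atTop_sets.2 ⟨σ N, fun n hn => ?_⟩
  by_cases hmem : ∃ k, σ k = n
  · obtain ⟨k, rfl⟩ := hmem
    simpa only [Set.mem_preimage, hσ.injective.extend_apply] using hN k (hσ.le_iff_le.1 hn)
  · simpa only [Set.mem_preimage, Function.extend_apply' _ _ _ hmem] using mem_of_mem_nhds hW

variable (hF : ∀ (w : ℕ → U) (u : U), Tendsto w atTop (𝓝 u) →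
  Tendsto (fun n => F n (w n)) atTop (𝓝 (f u)))

include hF

theorem tendsto_uncurry_of_seq_tendsto (u : U) :
    Tendsto (Function.uncurry F) (atTop ×ˢ 𝓝 u) (𝓝 (f u)) := by
  refine tendsto_of_seq_tendsto fun z hz => tendsto_of_subseq_tendsto fun ns hns => ?_
  obtain ⟨hz₁, hz₂⟩ := tendsto_prod_iff'.1 (hz.comp hns)
  obtain ⟨φ, hφ, hσ⟩ := strictMono_subseq_of_tendsto_atTop hz₁
  have hlim := hF _ u (tendsto_extend_strictMono hσ (hz₂.comp hφ.tendsto_atTop))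
  refine ⟨φ, (hlim.comp hσ.tendsto_atTop).congr fun k => ?_⟩
  rw [Function.comp_apply, hσ.injective.extend_apply]
  rfl

theorem continuous_of_seq_tendsto : Continuous f := by
  refine continuous_iff_continuousAt.2 fun u =>
    (closed_nhds_basis (f u)).tendsto_right_iff.2 fun V ⟨hV, hVc⟩ => ?_
  obtain ⟨p, hp, q, hq, hpq⟩ := eventually_prod_iff.1 (tendsto_uncurry_of_seq_tendsto hF u hV)
  filter_upwards [hq] with v hv
  exact hVc.mem_of_tendsto (hF (fun _ => v) v tendsto_const_nhds) (hp.mono fun n hn => hpq hn hv)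

theorem tendstoUniformly_of_seq_tendsto [CompactSpace U] : TendstoUniformly F f atTop := by
  rw [← tendstoLocallyUniformly_iff_tendstoUniformly_of_compactSpace,
    tendstoLocallyUniformly_iff_forall_tendsto]
  intro u
  have hf : Tendsto (fun p : ℕ × U => f p.2) (atTop ×ˢ 𝓝 u) (𝓝 (f u)) :=
    ((continuous_of_seq_tendsto hF).tendsto u).comp tendsto_snd
  exact (hf.prodMk_nhds (tendsto_uncurry_of_seq_tendsto hF u)).mono_right
    (nhds_le_uniformity (f u))

end ContinuousConvergence

section SetwiseConvergence

variable {X U : Type*} [MeasurableSpace X] [MeasurableSpace U]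

/-- Pointwise convergence of a uniformly bounded sequence of measurable functions: the mode of
convergence of functions that integrates against setwise convergence of measures. -/
structure BddPointwiseTendsto (f : ℕ → X → ℝ) (φ : X → ℝ) : Prop where
  measurable : ∀ n, Measurable (f n)
  bdd : ∃ C : ℝ, ∀ n x, |f n x| ≤ C
  tendsto : ∀ x, Tendsto (fun n => f n x) atTop (𝓝 (φ x))

/-- Continuous convergence of transition kernels: `S n (· | x, u_n) → T (· | x, u)` setwise
whenever `u_n → u`. -/
def SetwiseContConv [TopologicalSpace U] (S : ℕ → Kernel (X × U) X) (T : Kernel (X × U) X) :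
    Prop :=
  ∀ (x : X) (w : ℕ → U) (u : U), Tendsto w atTop (𝓝 u) →
    SetwiseTendsto (fun n => S n (x, w n)) (T (x, u))

namespace BddPointwiseTendsto

variable {f g : ℕ → X → ℝ} {φ ψ : X → ℝ}

theorem const (hφ : BddMeasurable φ) : BddPointwiseTendsto (fun _ => φ) φ :=
  ⟨fun _ => hφ.measurable, hφ.bdd.imp fun _ h _ => h, fun _ => tendsto_const_nhds⟩

theorem bddMeasurable (hf : BddPointwiseTendsto f φ) (n : ℕ) : BddMeasurable (f n) :=
  ⟨hf.measurable n, hf.bdd.imp fun _ h => h n⟩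

theorem bddMeasurable_lim (hf : BddPointwiseTendsto f φ) : BddMeasurable φ := by
  obtain ⟨C, hC⟩ := hf.bdd
  exact ⟨measurable_of_tendsto_metrizable hf.measurable (tendsto_pi_nhds.2 hf.tendsto), C,
    fun x => le_of_tendsto (hf.tendsto x).abs (Eventually.of_forall fun n => hC n x)⟩

theorem sub (hf : BddPointwiseTendsto f φ) (hg : BddPointwiseTendsto g ψ) :
    BddPointwiseTendsto (fun n x => f n x - g n x) fun x => φ x - ψ x := by
  obtain ⟨C, hC⟩ := hf.bdd
  obtain ⟨D, hD⟩ := hg.bdd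
  exact ⟨fun n => (hf.measurable n).sub (hg.measurable n),
    ⟨C + D, fun n x => (abs_sub _ _).trans (add_le_add (hC n x) (hD n x))⟩,
    fun x => (hf.tendsto x).sub (hg.tendsto x)⟩

theorem tendsto_integral (hf : BddPointwiseTendsto f φ) (μ : Measure X) [IsFiniteMeasure μ] :
    Tendsto (fun n => ∫ x, f n x ∂μ) atTop (𝓝 (∫ x, φ x ∂μ)) := by
  obtain ⟨C, hC⟩ := hf.bdd
  exact tendsto_integral_of_dominated_convergence (fun _ => C)
    (fun n => (hf.measurable n).aestronglyMeasurable) (integrable_const C)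
    (fun n => Eventually.of_forall (hC n)) (Eventually.of_forall hf.tendsto)

theorem exists_tail_bound (hf : BddPointwiseTendsto f φ) :
    ∃ G : ℕ → X → ℝ, BddPointwiseTendsto G (fun _ => 0) ∧
      ∀ m n, m ≤ n → ∀ x, |f n x - φ x| ≤ G m x := by
  have hsub := hf.sub (const hf.bddMeasurable_lim)
  obtain ⟨C, hC⟩ := hsub.bdd
  have hle (m : ℕ) {n : ℕ} (hmn : m ≤ n) (x : X) :
      |f n x - φ x| ≤ ⨆ k, |f (m + k) x - φ x| := by
    obtain ⟨k, rfl⟩ := Nat.exists_eq_add_of_le hmn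
    exact le_ciSup (f := fun k => |f (m + k) x - φ x|)
      ⟨C, Set.forall_mem_range.2 fun k => hC _ x⟩ k
  have hnonneg (m : ℕ) (x : X) : 0 ≤ ⨆ k, |f (m + k) x - φ x| :=
    (abs_nonneg _).trans (hle m le_rfl x)
  refine ⟨fun m x => ⨆ k, |f (m + k) x - φ x|, ⟨fun m => .iSup fun k =>
    (hsub.measurable (m + k)).abs, ⟨C, fun m x => ?_⟩, fun x => ?_⟩, fun m n => hle m⟩
  · rw [abs_of_nonneg (hnonneg m x)]
    exact ciSup_le fun k => hC _ x
  · refine Metric.tendsto_atTop.2 fun ε hε => ?_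
    obtain ⟨N, hN⟩ := Metric.tendsto_atTop.1 (hf.tendsto x) (ε / 2) (half_pos hε)
    refine ⟨N, fun m hm => ?_⟩
    rw [Real.dist_0_eq_abs, abs_of_nonneg (hnonneg m x)]
    exact (ciSup_le fun k => (hN (m + k) (hm.trans (m.le_add_right k))).le).trans_lt
      (half_lt_self hε)

end BddPointwiseTendsto

theorem SetwiseTendsto.tendsto_integral {μ : ℕ → Measure X} {ν : Measure X}
    [∀ n, IsProbabilityMeasure (μ n)] [IsProbabilityMeasure ν] (hμ : SetwiseTendsto μ ν)
    {f : ℕ → X → ℝ} {φ : X → ℝ} (hf : BddPointwiseTendsto f φ) :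
    Tendsto (fun n => ∫ x, f n x ∂μ n) atTop (𝓝 (∫ x, φ x ∂ν)) := by
  obtain ⟨G, hG, hfG⟩ := hf.exists_tail_bound
  have hφ := hf.bddMeasurable_lim
  suffices Tendsto (fun n => ∫ x, f n x ∂μ n - ∫ x, φ x ∂μ n) atTop (𝓝 0) by
    simpa using this.add (hμ φ hφ.measurable hφ.bdd)
  have hGν : Tendsto (fun m => ∫ x, G m x ∂ν) atTop (𝓝 0) := by
    simpa using hG.tendsto_integral ν
  refine Metric.tendsto_nhds.2 fun ε hε => ?_
  obtain ⟨m, hm⟩ := (hGν.eventually (gt_mem_nhds hε)).exists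
  have hGm := hG.bddMeasurable m
  filter_upwards [(hμ (G m) hGm.measurable hGm.bdd).eventually (gt_mem_nhds hm),
    eventually_ge_atTop m] with n hn hmn
  have hfn := hf.bddMeasurable n
  rw [Real.dist_0_eq_abs, ← integral_sub (hfn.integrable _) (hφ.integrable _)]
  calc |∫ x, f n x - φ x ∂μ n| ≤ ∫ x, |f n x - φ x| ∂μ n := abs_integral_le_integral_abs
    _ ≤ ∫ x, G m x ∂μ n := integral_mono ((hfn.sub hφ).integrable _).abs (hGm.integrable _)
        (hfG m n hmn)
    _ < ε := hn

variable [TopologicalSpace U] [FirstCountableTopology U] {T : Kernel (X × U) X} {f : ℕ → X → ℝ}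
  {φ : X → ℝ}

section

variable {S : ℕ → Kernel (X × U) X} (hS : SetwiseContConv S T)

include hS

namespace SetwiseContConv

theorem continuous_integral (hφ : BddMeasurable φ) (x : X) :
    Continuous fun u => ∫ y, φ y ∂T (x, u) :=
  continuous_of_seq_tendsto (F := fun n u => ∫ y, φ y ∂S n (x, u)) fun w u hw =>
    hS x w u hw φ hφ.measurable hφ.bdd

theorem const_lim : SetwiseContConv (fun _ => T) T := fun x _ u hw _ hφ hφb =>
  ((hS.continuous_integral ⟨hφ, hφb⟩ x).tendsto u).comp hw

variable [CompactSpace U] [∀ n, IsMarkovKernel (S n)] [IsMarkovKernel T]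

theorem tendstoUniformly_integral (hf : BddPointwiseTendsto f φ) (x : X) :
    TendstoUniformly (fun n u => ∫ y, f n y ∂S n (x, u)) (fun u => ∫ y, φ y ∂T (x, u)) atTop :=
  tendstoUniformly_of_seq_tendsto fun w u hw => (hS x w u hw).tendsto_integral hf

theorem transitionOp_sub (hf : BddPointwiseTendsto f φ) (g : ℕ → StationaryPolicy X U) :
    BddPointwiseTendsto (fun n x => transitionOp (closedLoop (S n) (g n)) (f n) x
      - transitionOp (closedLoop T (g n)) φ x) fun _ => 0 := by
  obtain ⟨C, hC⟩ := hf.bdd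
  have hφ := hf.bddMeasurable_lim
  obtain ⟨D, hD⟩ := hφ.bdd
  refine ⟨fun n => (((hf.bddMeasurable n).transitionOp _).sub (hφ.transitionOp _)).measurable,
    ⟨C + D, fun n x => (abs_sub _ _).trans (add_le_add
      (abs_integral_le_of_forall_abs_le _ (hC n)) (abs_integral_le_of_forall_abs_le _ hD))⟩,
    fun x => Metric.tendsto_nhds.2 fun ε hε => ?_⟩
  filter_upwards [Metric.tendstoUniformly_iff.1 (hS.tendstoUniformly_integral hf x) ε hε] with n hn
  rw [Real.dist_0_eq_abs, abs_sub_comm]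
  exact hn ((g n).act x)

theorem transitionOp_stepKernel (hφ : BddMeasurable φ) (g : StationaryPolicy X U) (k : ℕ) :
    BddPointwiseTendsto (fun n => transitionOp (stepKernel (S n) g k) φ)
      (transitionOp (stepKernel T g k) φ) := by
  induction k with
  | zero =>
    simpa only [transitionOp_stepKernel_zero _ g hφ] using BddPointwiseTendsto.const hφ
  | succ k ih =>
    have hstep := (hS.transitionOp_sub ih fun _ => g).sub
      (.const (((hφ.transitionOp (stepKernel T g k)).transitionOp (closedLoop T g)).const_mul (-1)))
    simpa only [neg_one_mul, sub_neg_eq_add, sub_add_cancel, zero_add,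
      ← transitionOp_stepKernel_succ' _ g hφ] using hstep

end SetwiseContConv

theorem ErgodicityCondition.of_setwiseContConv [CompactSpace U] [∀ n, IsMarkovKernel (S n)]
    [IsMarkovKernel T] {t : ℕ} {β : ℝ} (hSβ : ∀ n, ErgodicityCondition (S n) t β) :
    ErgodicityCondition T t β := by
  intro g x x'
  refine Real.sSup_le ?_ ((tvDistance_nonneg _ _).trans (hSβ 0 g x x'))
  rintro _ ⟨f, hf, hf1, rfl⟩
  have hlim := hS.transitionOp_stepKernel ⟨hf, 1, hf1⟩ g t
  refine le_of_tendsto ((hlim.tendsto x).sub (hlim.tendsto x')).abs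
    (Eventually.of_forall fun n => ?_)
  refine (abs_integral_sub_integral_le_mul_tvDistance _ _ hf hf1).trans ?_
  rw [one_mul]
  exact hSβ n g x x'

end

theorem SetwiseContConv.transitionOp_stepKernel_null [CompactSpace U] [IsMarkovKernel T]
    (hT : SetwiseContConv (fun _ => T) T) (hf : BddPointwiseTendsto f fun _ => 0)
    (g : ℕ → StationaryPolicy X U) (k : ℕ) :
    BddPointwiseTendsto (fun n => transitionOp (stepKernel T (g n) k) (f n)) fun _ => 0 := by
  induction k with
  | zero => simpa only [transitionOp_stepKernel_zero _ _ (hf.bddMeasurable _)] using hf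
  | succ k ih =>
    simpa only [transitionOp_const, sub_zero,
      ← transitionOp_stepKernel_succ' _ _ (hf.bddMeasurable _)] using hT.transitionOp_sub ih g

end SetwiseConvergence

section BellmanConvergence

theorem tendsto_ciInf_of_tendstoUniformly {ι κ : Type*} [Nonempty ι] {l : Filter κ} {F : κ → ι → ℝ}
    {f : ι → ℝ} (h : TendstoUniformly F f l) (hF : ∀ n, BddBelow (Set.range (F n)))
    (hf : BddBelow (Set.range f)) : Tendsto (fun n => ⨅ i, F n i) l (𝓝 (⨅ i, f i)) := by
  refine Metric.tendsto_nhds.2 fun ε hε => ?_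
  filter_upwards [Metric.tendstoUniformly_iff.1 h (ε / 2) (half_pos hε)] with n hn
  have hinf := abs_ciInf_sub_ciInf_sub_le (hF n) hf (a := 0) fun i => by
    rw [sub_zero, abs_sub_comm]
    exact (hn i).le
  rw [sub_zero] at hinf
  exact hinf.trans_lt (half_lt_self hε)

variable {X U ι : Type*} [MeasurableSpace X] [MeasurableSpace U] [TopologicalSpace U]
  [FirstCountableTopology U] [CompactSpace U] [Nonempty ι] [Countable ι] {c : X → U → ℝ}
  {S : ℕ → Kernel (X × U) X} [∀ n, IsMarkovKernel (S n)] {T : Kernel (X × U) X}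
  [IsMarkovKernel T] {G : ι → StationaryPolicy X U} {α : ℝ}

theorem BddPointwiseTendsto.bellman (hS : SetwiseContConv S T)
    (hc : BddMeasurable (Function.uncurry c)) (hα : 0 ≤ α) {w : ℕ → X → ℝ} {φ : X → ℝ}
    (hw : BddPointwiseTendsto w φ) :
    BddPointwiseTendsto (fun n => bellman c (S n) G α (w n)) (bellman c T G α φ) := by
  obtain ⟨K, hK⟩ := hc.bdd
  obtain ⟨C, hC⟩ := hw.bdd
  refine ⟨fun n => (hc.bellman (hw.bddMeasurable n)).measurable,
    ⟨K + α * C, fun n x => abs_bellman_le (fun x u => hK (x, u)) hα (hC n) x⟩, fun x => ?_⟩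
  have hcost : TendstoUniformly (fun (_ : ℕ) u => c x u) (c x) atTop := fun s hs =>
    Eventually.of_forall fun _ _ => refl_mem_uniformity hs
  have hunif : TendstoUniformly (fun n u => c x u + α * ∫ y, w n y ∂S n (x, u))
      (fun u => c x u + α * ∫ y, φ y ∂T (x, u)) atTop :=
    hcost.add <| Real.uniformContinuous_const_mul.comp_tendstoUniformly
      (hS.tendstoUniformly_integral hw x)
  exact tendsto_ciInf_of_tendstoUniformly (hunif.comp fun i => (G i).act x)
    (fun n => bddBelow_range_policyBackup hc (hw.bddMeasurable n) x)
    (bddBelow_range_policyBackup hc hw.bddMeasurable_lim x)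

theorem bddPointwiseTendsto_bellman_iterate (hS : SetwiseContConv S T)
    (hc : BddMeasurable (Function.uncurry c)) (hα : 0 ≤ α) (k : ℕ) :
    BddPointwiseTendsto (fun n => (bellman c (S n) G α)^[k] 0) ((bellman c T G α)^[k] 0) := by
  induction k with
  | zero => exact .const (.const 0)
  | succ k ih =>
    simp only [Function.iterate_succ_apply']
    exact ih.bellman hS hc hα

end BellmanConvergence

section Cost

variable {X U : Type*} [MeasurableSpace X] [MeasurableSpace U]

theorem measurable_finSnoc {Ω Y : Type*} [MeasurableSpace Ω] [MeasurableSpace Y] {k : ℕ}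
    {f : Ω → Fin k → Y} {g : Ω → Y} (hf : Measurable f) (hg : Measurable g) :
    Measurable fun ω => (Fin.snoc (α := fun _ => Y) (f ω) (g ω) : Fin (k + 1) → Y) := by
  refine measurable_pi_iff.2 fun i => ?_
  induction i using Fin.lastCases with
  | last => simpa only [Fin.snoc_last] using hg
  | cast i => simpa only [Fin.snoc_castSucc] using measurable_pi_iff.1 hf i

theorem measurable_lastState (t : ℕ) :
    Measurable fun h : History X U t => h.1 (Fin.last t) :=
  (measurable_pi_apply _).comp measurable_fst

namespace AdmissiblePolicy

theorem measurable_snoc (γ : AdmissiblePolicy X U) (t : ℕ) :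
    Measurable fun p : History X U t × X => ((Fin.snoc (α := fun _ => X) p.1.1 p.2,
      Fin.snoc (α := fun _ => U) p.1.2 (γ.act t p.1)) : History X U (t + 1)) :=
  (measurable_finSnoc (measurable_fst.comp measurable_fst) measurable_snd).prodMk
    (measurable_finSnoc (measurable_snd.comp measurable_fst)
      ((γ.measurable_act t).comp measurable_fst))

theorem measurable_stateAction (γ : AdmissiblePolicy X U) (t : ℕ) :
    Measurable fun h : History X U t => (h.1 (Fin.last t), γ.act t h) :=
  (measurable_lastState t).prodMk (γ.measurable_act t)

end AdmissiblePolicy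

instance isMarkovKernel_nextState (T : Kernel (X × U) X) [IsMarkovKernel T]
    (γ : AdmissiblePolicy X U) (t : ℕ) : IsMarkovKernel (nextState T γ t) := by
  unfold nextState
  infer_instance

instance isProbabilityMeasure_histLaw (T : Kernel (X × U) X) [IsMarkovKernel T]
    (γ : AdmissiblePolicy X U) (x : X) (t : ℕ) : IsProbabilityMeasure (histLaw T γ x t) := by
  induction t with
  | zero =>
    unfold histLaw
    infer_instance
  | succ t ih =>
    unfold histLaw
    exact Measure.isProbabilityMeasure_map (γ.measurable_snoc t).aemeasurable

theorem bddMeasurable_stageCost {c : X → U → ℝ} (hc : BddMeasurable (Function.uncurry c))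
    (γ : AdmissiblePolicy X U) (t : ℕ) :
    BddMeasurable fun h : History X U t => c (h.1 (Fin.last t)) (γ.act t h) :=
  hc.comp (γ.measurable_stateAction t)

theorem bddMeasurable_totalCost {c : X → U → ℝ} (hc : BddMeasurable (Function.uncurry c))
    (t : ℕ) : BddMeasurable fun h : History X U t => ∑ i : Fin t, c (h.1 i.castSucc) (h.2 i) := by
  obtain ⟨K, hK⟩ := hc.bdd
  have hm (i : Fin t) : Measurable fun h : History X U t => (h.1 i.castSucc, h.2 i) :=
    ((measurable_pi_apply _).comp measurable_fst).prodMk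
      ((measurable_pi_apply _).comp measurable_snd)
  exact ⟨Finset.measurable_sum _ fun i _ => hc.measurable.comp (hm i), ∑ _i : Fin t, K, fun h =>
    (Finset.abs_sum_le_sum_abs _ _).trans (Finset.sum_le_sum fun i _ => hK (_, _))⟩

variable (T : Kernel (X × U) X) (γ : AdmissiblePolicy X U) (x : X)

theorem integral_lastState_histLaw_zero {f : X → ℝ} (hf : BddMeasurable f) :
    ∫ h, f (h.1 (Fin.last 0)) ∂histLaw T γ x 0 = f x := by
  rw [histLaw, integral_dirac' _ _ (hf.comp (measurable_lastState 0)).measurable.stronglyMeasurable]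

theorem finiteCost_zero (c : X → U → ℝ) : finiteCost c T γ 0 x = 0 := by
  simp [finiteCost]

variable [IsMarkovKernel T]

theorem integral_histLaw_succ (t : ℕ) {φ : History X U (t + 1) → ℝ} (hφ : BddMeasurable φ) :
    ∫ h, φ h ∂histLaw T γ x (t + 1) = ∫ h, ∫ y, φ (Fin.snoc (α := fun _ => X) h.1 y,
      Fin.snoc (α := fun _ => U) h.2 (γ.act t h)) ∂T (h.1 (Fin.last t), γ.act t h)
        ∂histLaw T γ x t := by
  have hm := γ.measurable_snoc t
  rw [histLaw, integral_map hm.aemeasurable hφ.measurable.aestronglyMeasurable,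
    Measure.integral_compProd ((hφ.comp hm).integrable _)]
  rfl

theorem integral_lastState_histLaw_succ (t : ℕ) {f : X → ℝ} (hf : BddMeasurable f) :
    ∫ h, f (h.1 (Fin.last (t + 1))) ∂histLaw T γ x (t + 1)
      = ∫ h, ∫ y, f y ∂T (h.1 (Fin.last t), γ.act t h) ∂histLaw T γ x t := by
  rw [integral_histLaw_succ T γ x t (hf.comp (measurable_lastState (t + 1)))]
  simp only [Fin.snoc_last]

variable {c : X → U → ℝ}

theorem abs_finiteCost_le {K : ℝ} (hK : ∀ x u, |c x u| ≤ K) (N : ℕ) :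
    |finiteCost c T γ N x| ≤ N * K := by
  refine abs_integral_le_of_forall_abs_le _ fun h => ?_
  calc |∑ i : Fin N, c (h.1 i.castSucc) (h.2 i)| ≤ ∑ _i : Fin N, K :=
        (Finset.abs_sum_le_sum_abs _ _).trans (Finset.sum_le_sum fun i _ => hK _ _)
    _ = N * K := by simp

variable (hc : BddMeasurable (Function.uncurry c))

include hc

theorem finiteCost_succ (N : ℕ) :
    finiteCost c T γ (N + 1) x
      = finiteCost c T γ N x + ∫ h, c (h.1 (Fin.last N)) (γ.act N h) ∂histLaw T γ x N := by
  rw [finiteCost, integral_histLaw_succ T γ x N (bddMeasurable_totalCost hc (N + 1)), finiteCost,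
    ← integral_add ((bddMeasurable_totalCost hc N).integrable _)
      ((bddMeasurable_stageCost hc γ N).integrable _)]
  refine integral_congr_ae (Eventually.of_forall fun h => ?_)
  simp only [Fin.sum_univ_castSucc, Fin.snoc_castSucc, Fin.snoc_last, integral_const,
    probReal_univ, one_smul]

theorem dynkin_formula {h : X → ℝ} (hh : BddMeasurable h) (N : ℕ) :
    finiteCost c T γ N x + ∫ ω, h (ω.1 (Fin.last N)) ∂histLaw T γ x N
      = h x + ∑ k ∈ Finset.range N, ∫ ω, (c (ω.1 (Fin.last k)) (γ.act k ω)
          + ∫ y, h y ∂T (ω.1 (Fin.last k), γ.act k ω) - h (ω.1 (Fin.last k)))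
            ∂histLaw T γ x k := by
  induction N with
  | zero =>
    rw [finiteCost_zero, integral_lastState_histLaw_zero T γ x hh, zero_add,
      Finset.sum_range_zero, add_zero]
  | succ N ih =>
    have hcost := bddMeasurable_stageCost hc γ N
    have hnext := (hh.kernelIntegral T).comp (γ.measurable_stateAction N)
    rw [Finset.sum_range_succ, ← add_assoc, ← ih, finiteCost_succ T γ x hc,
      integral_lastState_histLaw_succ T γ x N hh,
      integral_sub ((hcost.add hnext).integrable _)
        ((hh.comp (measurable_lastState N)).integrable _),
      integral_add (hcost.integrable _) (hnext.integrable _)]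
    ring

theorem bddMeasurable_dynkinIntegrand {h : X → ℝ} (hh : BddMeasurable h) :
    BddMeasurable fun p : X × U => c p.1 p.2 + ∫ y, h y ∂T p - h p.1 :=
  (hc.add (hh.kernelIntegral T)).sub (hh.comp measurable_fst)

theorem exists_mul_sub_le_finiteCost {h : X → ℝ} (hh : BddMeasurable h) {j : ℝ}
    (hj : ∀ x u, h x + j ≤ c x u + ∫ y, h y ∂T (x, u)) :
    ∃ C : ℝ, ∀ N : ℕ, N * j - C ≤ finiteCost c T γ N x := by
  obtain ⟨C, hC⟩ := hh.bdd
  refine ⟨C + C, fun N => ?_⟩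
  have hdynkin := dynkin_formula T γ x hc hh N
  have hsum := Finset.card_nsmul_le_sum (Finset.range N) _ j fun k _ =>
    ((bddMeasurable_dynkinIntegrand T hc hh).comp (γ.measurable_stateAction k)).le_integral
      (fun ω => by linarith [hj (ω.1 (Fin.last k)) (γ.act k ω)]) (histLaw T γ x k)
  rw [Finset.card_range, nsmul_eq_mul] at hsum
  have hlast := abs_le.1 <| abs_integral_le_of_forall_abs_le (histLaw T γ x N)
    fun ω => hC (ω.1 (Fin.last N))
  linarith [(abs_le.1 (hC x)).1, hlast.2]

theorem exists_finiteCost_toAdmissible_le {g : StationaryPolicy X U} {h : X → ℝ}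
    (hh : BddMeasurable h) {j : ℝ} (hj : ∀ x, policyBackup c T 1 g h x ≤ h x + j) :
    ∃ C : ℝ, ∀ N : ℕ, finiteCost c T g.toAdmissible N x ≤ N * j + C := by
  obtain ⟨C, hC⟩ := hh.bdd
  refine ⟨C + C, fun N => ?_⟩
  have hdynkin := dynkin_formula T g.toAdmissible x hc hh N
  have hstep (y : X) : c y (g.act y) + ∫ z, h z ∂T (y, g.act y) - h y ≤ j := by
    have := hj y
    rw [policyBackup, one_mul] at this
    exact sub_le_iff_le_add'.2 this
  have hsum := Finset.sum_le_card_nsmul (Finset.range N) _ j fun k _ =>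
    ((bddMeasurable_dynkinIntegrand T hc hh).comp
      (g.toAdmissible.measurable_stateAction k)).integral_le
      (fun ω => hstep (ω.1 (Fin.last k))) (histLaw T g.toAdmissible x k)
  rw [Finset.card_range, nsmul_eq_mul] at hsum
  have hlast := abs_le.1 <| abs_integral_le_of_forall_abs_le (histLaw T g.toAdmissible x N)
    fun ω => hC (ω.1 (Fin.last N))
  linarith [(abs_le.1 (hC x)).2, hlast.1]

theorem exists_abs_avg_le : ∃ K : ℝ, ∀ N : ℕ, |1 / (N : ℝ) * finiteCost c T γ N x| ≤ K := by
  obtain ⟨K, hK⟩ := hc.bdd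
  refine ⟨|K|, fun N => ?_⟩
  have hN := abs_finiteCost_le T γ x (fun x u => (hK (x, u)).trans (le_abs_self K)) N
  rcases N.eq_zero_or_pos with rfl | hpos
  · simp
  · rw [one_div, abs_mul, abs_inv, Nat.abs_cast, inv_mul_le_iff₀ (Nat.cast_pos.2 hpos)]
    exact hN

theorem le_avgCost_of_forall_le {j C : ℝ} (h : ∀ N : ℕ, N * j - C ≤ finiteCost c T γ N x) :
    j ≤ avgCost c T γ x := by
  obtain ⟨K, hK⟩ := exists_abs_avg_le T γ x hc
  have hlim : Tendsto (fun N : ℕ => j - C / N) atTop (𝓝 j) := by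
    simpa using tendsto_const_nhds.sub (tendsto_const_div_atTop_nhds_zero_nat C)
  rw [avgCost, ← hlim.limsup_eq]
  refine limsup_le_limsup ?_ hlim.isCoboundedUnder_le
    (isBoundedUnder_of ⟨K, fun N => (abs_le.1 (hK N)).2⟩)
  filter_upwards [eventually_gt_atTop 0] with N hN
  have hN' : (0 : ℝ) < N := Nat.cast_pos.2 hN
  rw [one_div, inv_mul_eq_div, le_div_iff₀ hN', sub_mul, div_mul_cancel₀ _ hN'.ne']
  linarith [h N]

theorem avgCost_le_of_forall_le {j C : ℝ} (h : ∀ N : ℕ, finiteCost c T γ N x ≤ N * j + C) :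
    avgCost c T γ x ≤ j := by
  obtain ⟨K, hK⟩ := exists_abs_avg_le T γ x hc
  have hlim : Tendsto (fun N : ℕ => j + C / N) atTop (𝓝 j) := by
    simpa using tendsto_const_nhds.add (tendsto_const_div_atTop_nhds_zero_nat C)
  have hbelow : IsBoundedUnder (· ≥ ·) atTop fun N : ℕ => 1 / (N : ℝ) * finiteCost c T γ N x :=
    isBoundedUnder_of ⟨-K, fun N => (abs_le.1 (hK N)).1⟩
  rw [avgCost, ← hlim.limsup_eq]
  refine limsup_le_limsup ?_ hbelow.isCoboundedUnder_le hlim.isBoundedUnder_le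
  filter_upwards [eventually_gt_atTop 0] with N hN
  have hN' : (0 : ℝ) < N := Nat.cast_pos.2 hN
  rw [one_div, inv_mul_eq_div, div_le_iff₀ hN', add_mul, div_mul_cancel₀ _ hN'.ne']
  linarith [h N]

theorem optAvgCost_le_avgCost : optAvgCost c T x ≤ avgCost c T γ x := by
  obtain ⟨K, hK⟩ := hc.bdd
  refine ciInf_le ⟨-K, ?_⟩ γ
  rintro _ ⟨γ, rfl⟩
  refine le_avgCost_of_forall_le T γ x hc (C := 0) fun N => ?_
  have := (abs_le.1 (abs_finiteCost_le (c := c) T γ x (fun x u => hK (x, u)) N)).1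
  linarith

omit γ in
theorem le_optAvgCost [Nonempty (AdmissiblePolicy X U)] {h : X → ℝ} (hh : BddMeasurable h) {j : ℝ}
    (hj : ∀ x u, h x + j ≤ c x u + ∫ y, h y ∂T (x, u)) : j ≤ optAvgCost c T x :=
  le_ciInf fun γ =>
    have ⟨_, hC⟩ := exists_mul_sub_le_finiteCost T γ x hc hh hj
    le_avgCost_of_forall_le T γ x hc hC

theorem avgCost_toAdmissible_le {g : StationaryPolicy X U} {h : X → ℝ} (hh : BddMeasurable h)
    {j : ℝ} (hj : ∀ x, policyBackup c T 1 g h x ≤ h x + j) : avgCost c T g.toAdmissible x ≤ j :=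
  have ⟨_, hC⟩ := exists_finiteCost_toAdmissible_le T x hc hh hj
  avgCost_le_of_forall_le T _ x hc hC

end Cost

section ApproximateOptimality

variable {X U : Type*} [MeasurableSpace X] [MeasurableSpace U] {c : X → U → ℝ}
  {T : Kernel (X × U) X} [IsMarkovKernel T] {w : X → ℝ}

/-- Adding `ρ` to the relative value function `h` replaces the error `ρ` by its one-step
expectation. -/
theorem exists_policyBackup_le_add_transitionOp {g : StationaryPolicy X U} {ρ : X → ℝ}
    (hw : BddMeasurable w) (hρ : BddMeasurable ρ) {j : ℝ}
    (hj : ∀ x, policyBackup c T 1 g w x ≤ w x + j + ρ x) (m : ℕ) :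
    ∃ h : X → ℝ, BddMeasurable h ∧
      ∀ x, policyBackup c T 1 g h x ≤ h x + j + transitionOp (stepKernel T g m) ρ x := by
  induction m with
  | zero => exact ⟨w, hw, by simpa only [transitionOp_stepKernel_zero T g hρ] using hj⟩
  | succ m ih =>
    obtain ⟨h, hh, hle⟩ := ih
    have hm : BddMeasurable (transitionOp (stepKernel T g m) ρ) := hρ.transitionOp _
    refine ⟨fun x => h x + transitionOp (stepKernel T g m) ρ x, hh.add hm, fun x => ?_⟩
    have hx := hle x
    rw [policyBackup] at hx ⊢
    rw [transitionOp_add _ hh hm, transitionOp_stepKernel_succ' T g hρ]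
    linarith

theorem ErgodicityCondition.avgCost_toAdmissible_le_add {t : ℕ} {β : ℝ}
    (hT : ErgodicityCondition T t β) (hc : BddMeasurable (Function.uncurry c))
    {g : StationaryPolicy X U} {ρ : X → ℝ} (hw : BddMeasurable w) (hρ : Measurable ρ) {R : ℝ}
    (hR : ∀ x, |ρ x| ≤ R) {j : ℝ} (hj : ∀ x, policyBackup c T 1 g w x ≤ w x + j + ρ x) (p : ℕ)
    (x : X) :
    avgCost c T g.toAdmissible x
      ≤ j + (transitionOp (stepKernel T g (t * p)) ρ x + β ^ p * (2 * R)) := by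
  have hρB : BddMeasurable ρ := ⟨hρ, R, hR⟩
  obtain ⟨h, hh, hle⟩ := exists_policyBackup_le_add_transitionOp hw hρB hj (t * p)
  refine avgCost_toAdmissible_le T x hc hh fun y => (hle y).trans ?_
  have hmix := hT.transitionOp_mul_sub_le g hρB (s := 2 * R)
    (fun y y' => by linarith [(abs_le.1 (hR y)).2, (abs_le.1 (hR y')).1]) p y x
  linarith

variable [TopologicalSpace U] [FirstCountableTopology U]

theorem ErgodicityCondition.eventually_avgCost_toAdmissible_le [CompactSpace U] {t : ℕ} {β : ℝ}
    (hT : ErgodicityCondition T t β) (hβ : β < 1) (hTcont : SetwiseContConv (fun _ => T) T)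
    (hc : BddMeasurable (Function.uncurry c)) (hw : BddMeasurable w) {g : ℕ → StationaryPolicy X U}
    {ρ : ℕ → X → ℝ} (hρ : BddPointwiseTendsto ρ fun _ => 0) {j : ℝ}
    (hj : ∀ n x, policyBackup c T 1 (g n) w x ≤ w x + j + ρ n x) {ε : ℝ} (hε : 0 < ε) (x : X) :
    ∀ᶠ n in atTop, avgCost c T (g n).toAdmissible x ≤ j + ε := by
  have : Nonempty X := ⟨x⟩
  obtain ⟨R, hR⟩ := hρ.bdd
  obtain ⟨p, hp⟩ : ∃ p : ℕ, β ^ p * (2 * R) < ε / 2 := by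
    have hlim := (tendsto_pow_atTop_nhds_zero_of_lt_one (hT.nonneg (g 0)) hβ).mul_const (2 * R)
    rw [zero_mul] at hlim
    exact (hlim.eventually (gt_mem_nhds (half_pos hε))).exists
  have hnull := (hTcont.transitionOp_stepKernel_null hρ g (t * p)).tendsto x
  filter_upwards [hnull.eventually (gt_mem_nhds (half_pos hε))] with n hn
  have := hT.avgCost_toAdmissible_le_add hc hw (hρ.measurable n) (hR n) (hj n) p x
  linarith

theorem bellman_le_of_denseRange {ι : Type*} {G : ι → StationaryPolicy X U}
    (hTcont : SetwiseContConv (fun _ => T) T) (hc : BddMeasurable (Function.uncurry c))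
    (hc_cont : ∀ x, Continuous (c x)) (hw : BddMeasurable w) {x : X}
    (hG : DenseRange fun i => (G i).act x) (u : U) :
    bellman c T G 1 w x ≤ c x u + ∫ y, w y ∂T (x, u) := by
  refine hG.induction_on u (isClosed_le continuous_const
    ((hc_cont x).add (hTcont.continuous_integral hw x))) fun i => ?_
  have := bellman_le_policyBackup (T := T) (G := G) (α := 1) hc hw i x
  rw [policyBackup, one_mul] at this
  exact this

/-- The near-optimality of `γ n = G (i n)` for `S n` transfers to `T` because the relative value
functions and the Bellman images converge and the integrals converge uniformly in the action. -/
theorem eventually_avgCost_toAdmissible_le_optAvgCost_add [CompactSpace U] {ι : Type*} [Countable ι]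
    {S : ℕ → Kernel (X × U) X} [∀ n, IsMarkovKernel (S n)] (hS : SetwiseContConv S T) {t : ℕ}
    {β : ℝ} (hβ : β < 1) (hSerg : ∀ n, ErgodicityCondition (S n) t β)
    (hc : BddMeasurable (Function.uncurry c)) (hc_cont : ∀ x, Continuous (c x))
    {G : ι → StationaryPolicy X U} (hG : ∀ x, DenseRange fun i => (G i).act x) {i : ℕ → ι}
    (hi : ∀ n, SatisfiesACOE c (S n) (G (i n))) {δ : ℝ} (hδ : 0 < δ) (x : X) :
    ∀ᶠ n in atTop, avgCost c T (G (i n)).toAdmissible x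
      ≤ optAvgCost c T x + (2 ^ (t + 3) / (1 - β) + 3) * δ := by
  have : Nonempty X := ⟨x⟩
  have : Nonempty ι := ⟨i 0⟩
  have : Nonempty (AdmissiblePolicy X U) := ⟨(G (i 0)).toAdmissible⟩
  have hTerg : ErgodicityCondition T t β := .of_setwiseContConv hS hSerg
  obtain ⟨α, hα, k, happrox⟩ := exists_forall_bellman_iterate_approx_acoe t hβ hc G hδ
  have hw := bddPointwiseTendsto_bellman_iterate (G := G) hS hc hα k
  set w := fun n => (bellman c (S n) G α)^[k] 0
  set W := (bellman c T G α)^[k] 0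
  obtain ⟨j, hj⟩ := happrox T hTerg
  have hj_le : j - δ ≤ optAvgCost c T x := le_optAvgCost T x hc hw.bddMeasurable_lim fun y u => by
    linarith [(abs_le.1 (hj y)).1,
      bellman_le_of_denseRange hS.const_lim hc hc_cont hw.bddMeasurable_lim (hG y) u]
  set ρ : ℕ → X → ℝ := fun n y => bellman c (S n) G 1 (w n) y - bellman c T G 1 W y
    - (transitionOp (closedLoop (S n) (G (i n))) (w n) y
      - transitionOp (closedLoop T (G (i n))) W y)
  have hρ : BddPointwiseTendsto ρ fun _ => 0 := by
    have hbellman := hw.bellman (G := G) hS hc zero_le_one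
    simpa only [sub_self] using (hbellman.sub (.const hbellman.bddMeasurable_lim)).sub
      (hS.transitionOp_sub hw fun n => G (i n))
  have hgreedy (n : ℕ) (y : X) : policyBackup c T 1 (G (i n)) W y
      ≤ W y + (j + (2 ^ (t + 3) / (1 - β) + 1) * δ) + ρ n y := by
    obtain ⟨jn, hjn⟩ := happrox (S n) (hSerg n)
    have hn := (hi n).policyBackup_le_bellman_add (hSerg n) hβ hc (hw.bddMeasurable n) hδ hjn y
    have hy := (abs_le.1 (hj y)).2
    simp only [policyBackup, ρ] at hn ⊢
    linarith
  filter_upwards [hTerg.eventually_avgCost_toAdmissible_le hβ hS.const_lim hc hw.bddMeasurable_lim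
    hρ hgreedy hδ x] with n hn
  linarith

/-- The stationary policy that always plays `u`. -/
def StationaryPolicy.const (u : U) : StationaryPolicy X U := ⟨fun _ => u, measurable_const⟩

end ApproximateOptimality

end AvgMDP

theorem mainTheorem3_general {X U : Type*} [MeasurableSpace X] [MeasurableSpace U]
    [TopologicalSpace U] [CompactSpace U] [FirstCountableTopology U]
    [TopologicalSpace.SeparableSpace U]
    (c : X → U → ℝ) (hc_meas : Measurable (Function.uncurry c))
    (hc_bdd : ∃ K : ℝ, ∀ x u, |c x u| ≤ K) (hc_cont : ∀ x, Continuous (c x))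
    (T : Kernel (X × U) X) [IsMarkovKernel T]
    (Tn : ℕ → Kernel (X × U) X) [∀ n, IsMarkovKernel (Tn n)]
    (t : ℕ) (β : ℝ) (hβ_lt : β < 1) (hTn_erg : ∀ n, AvgMDP.ErgodicityCondition (Tn n) t β)
    (h_conv : AvgMDP.SetwiseContConv Tn T) (γ : ℕ → AvgMDP.StationaryPolicy X U)
    (hγ : ∀ n, AvgMDP.SatisfiesACOE c (Tn n) (γ n)) (x : X) :
    Tendsto (fun n => AvgMDP.avgCost c T (γ n).toAdmissible x) atTop
      (𝓝 (AvgMDP.optAvgCost c T x)) := by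
  have : Nonempty U := ⟨(γ 0).act x⟩
  have hc : AvgMDP.BddMeasurable (Function.uncurry c) :=
    ⟨hc_meas, hc_bdd.imp fun K hK p => hK p.1 p.2⟩
  let G : ℕ ⊕ ℕ → AvgMDP.StationaryPolicy X U :=
    Sum.elim γ fun k => .const (TopologicalSpace.denseSeq U k)
  have hG (y : X) : DenseRange fun i => (G i).act y :=
    (TopologicalSpace.denseRange_denseSeq U).mono <| Set.range_subset_iff.2 fun k => ⟨.inr k, rfl⟩
  refine tendsto_order.2 ⟨fun a ha => .of_forall fun n =>
    ha.trans_le (AvgMDP.optAvgCost_le_avgCost T _ x hc), fun b hb => ?_⟩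
  obtain ⟨δ, hδ, hδb⟩ := exists_pos_mul_lt (sub_pos.2 hb) ((2 : ℝ) ^ (t + 3) / (1 - β) + 3)
  filter_upwards [AvgMDP.eventually_avgCost_toAdmissible_le_optAvgCost_add h_conv hβ_lt hTn_erg hc
    hc_cont hG (i := Sum.inl) hγ hδ x] with n hn
  exact hn.trans_lt (by linarith)

theorem mainTheorem3 {d m : ℕ}
    (X : Set (EuclideanSpace ℝ (Fin d))) (hX : MeasurableSet X)
    (U : Set (EuclideanSpace ℝ (Fin m))) (hU : IsCompact U)
    (c : X → U → ℝ) (hc_meas : Measurable (Function.uncurry c))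
    (hc_bdd : ∃ K : ℝ, ∀ x u, |c x u| ≤ K)
    (hc_cont : ∀ x, Continuous (c x))
    (T : Kernel (X × U) X) [IsMarkovKernel T]
    (Tn : ℕ → Kernel (X × U) X) [∀ n, IsMarkovKernel (Tn n)]
    (t : ℕ) (ht : 0 < t) (β : ℝ) (hβ_pos : 0 < β) (hβ_lt : β < 1)
    (hT_erg : AvgMDP.ErgodicityCondition T t β)
    (hTn_erg : ∀ n, AvgMDP.ErgodicityCondition (Tn n) t β)
    (hT_cont : ∀ (x : X) (w : ℕ → U) (u : U), Tendsto w atTop (𝓝 u) →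
      AvgMDP.SetwiseTendsto (fun n => T (x, w n)) (T (x, u)))
    (h_conv : ∀ (x : X) (w : ℕ → U) (u : U), Tendsto w atTop (𝓝 u) →
      AvgMDP.SetwiseTendsto (fun n => Tn n (x, w n)) (T (x, u)))
    (γ : ℕ → AvgMDP.StationaryPolicy X U)
    (hγ : ∀ n, AvgMDP.SatisfiesACOE c (Tn n) (γ n)) :
    ∀ x : X, Tendsto (fun n => AvgMDP.avgCost c T (γ n).toAdmissible x) atTop
      (𝓝 (AvgMDP.optAvgCost c T x)) := by
  have : CompactSpace U := isCompact_iff_compactSpace.1 hU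
  exact mainTheorem3_general c hc_meas hc_bdd hc_cont T Tn t β hβ_lt hTn_erg h_conv γ hγ
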